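/- Let $a,b:[0,1]\to\mathbb R$ be continuous with $a(0)=0$, $a>0$ on $(0,1]$ and $b/a\in L^1(0,1)$, and suppose that for some $K>0$ the function $x\mapsto x^K/a(x)$ is nondecreasing in a right neighbourhood of $0$. Let $\beta\ge 0$ and put $$\eta(x)=\exp\Big(\int_{1/2}^x\frac{b(s)}{a(s)}\,ds\Big),\qquad \sigma(x)=\frac{a(x)}{\eta(x)},\qquad Au=au''+bu'.$$ Let $L^2_{1/\sigma}(0,1)$ be the space of (real) $u\in L^2(0,1)$ with $\int_0^1u^2/\sigma\,dx<\infty$, with inner product $\int_0^1 uv/\sigma\,dx$. Let $$H^1_{1/\sigma,0}(0,1)=\{u\in H^1(0,1)\cap L^2_{1/\sigma}(0,1):u(0)=0\},\qquad H^2_{1/\sigma,0}(0,1)=\{u\in H^1_{1/\sigma,0}(0,1):Au\in L^2_{1/\sigma}(0,1)\},$$ where $u'$ and $u''$ are weak derivatives, with $u''\in L^1_{\rm loc}(0,1)$ in the second space. Equip $\mathcal H_0=H^1_{1/\sigma,0}(0,1)\times L^2_{1/\sigma}(0,1)$ with the inner product $$\langle(u,v),(\tilde u,\tilde v)\rangle_1=\int_0^1\eta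 u'\tilde u'\,dx+\int_0^1\frac{v\tilde v}{\sigma}\,dx+\beta u(1)\tilde u(1)$$ and its norm, and let $\mathcal A(u,v)=(v,Au)$ with domain $$D(\mathcal A)=\{(u,v)\in H^2_{1/\sigma,0}(0,1)\times H^1_{1/\sigma,0}(0,1):(\eta u')(1)+v(1)+\beta u(1)=0\},$$ where $(\eta u')(1)$ is the value at $1$ of the representative of $\eta u'$ that is continuous on $(0,1]$. Then $\mathcal A$ is dissipative (non-positive), i.e. $\langle\mathcal AY,Y\rangle_1\le 0$ for all $Y\in D(\mathcal A)$; $D(\mathcal A)$ is dense in $\mathcal H_0$; and $\mathcal A$ generates a contraction semigroup on $\mathcal H_0$: there is a strongly continuous semigroup $(S(t))_{t\ge0}$ of linear operators on $\mathcal H_0$ with $\|S(t)Y\|\le\|Y\|$ for all $t\ge 0$ and $Y\in\mathcal H_0$, whose generator is exactly $(\mathcal A,D(\mathcal A))$. -/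

import Mathlib

open Set Filter Topology MeasureTheory
open scoped ContDiff NNReal InnerProductSpace

namespace DegenerateWave

noncomputable section

/-! ### Coefficients and weights -/

/-- The standing assumptions on the coefficients `a, b` (only their values on `[0,1]` matter). -/
structure Admissible (a b : ℝ → ℝ) : Prop where
  continuousOn_a : ContinuousOn a (Icc 0 1)
  continuousOn_b : ContinuousOn b (Icc 0 1)
  integrable_div : IntegrableOn (fun x => b x / a x) (Ioo 0 1)
  a_zero : a 0 = 0
  a_pos : ∀ x ∈ Ioc (0 : ℝ) 1, 0 < a x
  monotone_near_zero : ∃ K : ℝ, 0 < K ∧ ∃ δ : ℝ, 0 < δ ∧ δ ≤ 1 ∧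
    MonotoneOn (fun x => x ^ K / a x) (Ioo 0 δ)

/-- The weight `η(x) = exp (∫_{1/2}^x b/a)`. -/
def eta (a b : ℝ → ℝ) (x : ℝ) : ℝ := Real.exp (∫ s in (1 / 2 : ℝ)..x, b s / a s)

/-- The weight `σ = a / η`. -/
def sigma (a b : ℝ → ℝ) (x : ℝ) : ℝ := a x / eta a b x

/-- Lebesgue measure on `(0,1)`. -/
abbrev leb : Measure ℝ := volume.restrict (Ioo 0 1)

/-- The measure `(1/σ) dx` on `(0,1)`. -/
def wMeasure (a b : ℝ → ℝ) : Measure ℝ :=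
  leb.withDensity (fun x => ENNReal.ofReal (1 / sigma a b x))

/-- The weighted space `L²_{1/σ}(0,1)`, with inner product `∫ u v / σ`. Since `1/σ` is bounded
below by a positive constant, its elements automatically lie in `L²(0,1)`. -/
abbrev L2w (a b : ℝ → ℝ) : Type := Lp ℝ 2 (wMeasure a b)

/-! ### Weak derivatives on `(0,1)` -/

/-- Test functions: `C_c^∞(0,1)`. -/
def IsTest (φ : ℝ → ℝ) : Prop :=
  ContDiff ℝ ∞ φ ∧ HasCompactSupport φ ∧ tsupport φ ⊆ Ioo 0 1

/-- `g ∈ L¹_loc(0,1)` is the weak derivative of `f ∈ L¹_loc(0,1)`. -/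
def HasWeakDeriv (f g : ℝ → ℝ) : Prop :=
  LocallyIntegrableOn f (Ioo 0 1) ∧ LocallyIntegrableOn g (Ioo 0 1) ∧
    ∀ φ : ℝ → ℝ, IsTest φ →
      ∫ x in Ioo (0 : ℝ) 1, f x * deriv φ x = -∫ x in Ioo (0 : ℝ) 1, g x * φ x

open Classical in
/-- A representative of the weak derivative of `f` on `(0,1)` (zero if there is none). -/
def weakDeriv (f : ℝ → ℝ) : ℝ → ℝ :=
  if h : ∃ g, HasWeakDeriv f g then h.choose else 0

theorem IsTest.deriv {φ : ℝ → ℝ} (h : IsTest φ) : IsTest (deriv φ) :=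
  ⟨(contDiff_infty_iff_deriv.1 h.1).2, h.2.1.deriv,
    (tsupport_deriv_subset).trans h.2.2⟩

theorem integrable_mul_test {f φ : ℝ → ℝ} (hf : LocallyIntegrableOn f (Ioo 0 1))
    (h : IsTest φ) : Integrable (fun x => f x * φ x) leb := by
  have h1 : IntegrableOn f (tsupport φ) :=
    (hf.mono_set h.2.2).integrableOn_isCompact h.2.1.isCompact
  have h2 : IntegrableOn (fun x => f x * φ x) (tsupport φ) :=
    h1.mul_continuousOn h.1.continuous.continuousOn h.2.1.isCompact
  have h3 : Integrable (fun x => f x * φ x) :=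
    (integrableOn_iff_integrable_of_support_subset (by
      intro x hx
      exact subset_tsupport _ (right_ne_zero_of_mul hx))).1 h2
  exact h3.integrableOn

theorem ae_zero_of_test {f : ℝ → ℝ} (hf : LocallyIntegrableOn f (Ioo 0 1))
    (h : ∀ φ, IsTest φ → ∫ x in Ioo (0 : ℝ) 1, f x * φ x = 0) : f =ᵐ[leb] 0 := by
  rw [Filter.EventuallyEq, ae_restrict_iff' measurableSet_Ioo]
  refine IsOpen.ae_eq_zero_of_integral_contDiff_smul_eq_zero isOpen_Ioo hf ?_
  intro g hg hc hs
  rw [← h g ⟨hg, hc, hs⟩, setIntegral_eq_integral_of_forall_compl_eq_zero]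
  · simp [mul_comm]
  · intro x hx
    rw [image_eq_zero_of_notMem_tsupport (fun h' => hx (hs h')), mul_zero]

theorem HasWeakDeriv.unique {f g₁ g₂ : ℝ → ℝ} (h₁ : HasWeakDeriv f g₁)
    (h₂ : HasWeakDeriv f g₂) : g₁ =ᵐ[leb] g₂ := by
  have := ae_zero_of_test (h₁.2.1.sub h₂.2.1) (fun φ hφ => by
    have e : ∀ x, (g₁ - g₂) x * φ x = g₁ x * φ x - g₂ x * φ x := fun x => by
      simp [sub_mul]
    simp_rw [e]
    rw [integral_sub (integrable_mul_test h₁.2.1 hφ) (integrable_mul_test h₂.2.1 hφ)]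
    have := h₁.2.2 φ hφ
    have := h₂.2.2 φ hφ
    linarith)
  filter_upwards [this] with x hx
  simpa [sub_eq_zero] using hx

theorem HasWeakDeriv.add {f₁ g₁ f₂ g₂ : ℝ → ℝ} (h₁ : HasWeakDeriv f₁ g₁)
    (h₂ : HasWeakDeriv f₂ g₂) : HasWeakDeriv (f₁ + f₂) (g₁ + g₂) := by
  refine ⟨h₁.1.add h₂.1, h₁.2.1.add h₂.2.1, fun φ hφ => ?_⟩
  simp only [Pi.add_apply, add_mul]
  rw [integral_add (integrable_mul_test h₁.1 hφ.deriv) (integrable_mul_test h₂.1 hφ.deriv),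
    integral_add (integrable_mul_test h₁.2.1 hφ) (integrable_mul_test h₂.2.1 hφ),
    h₁.2.2 φ hφ, h₂.2.2 φ hφ]
  ring

theorem HasWeakDeriv.smul {f g : ℝ → ℝ} (c : ℝ) (h : HasWeakDeriv f g) :
    HasWeakDeriv (c • f) (c • g) := by
  refine ⟨h.1.smul c, h.2.1.smul c, fun φ hφ => ?_⟩
  simp only [Pi.smul_apply, smul_eq_mul, mul_assoc]
  rw [integral_const_mul, integral_const_mul, h.2.2 φ hφ]
  ring

theorem hasWeakDeriv_zero : HasWeakDeriv 0 0 :=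
  ⟨locallyIntegrableOn_zero, locallyIntegrableOn_zero, fun φ _ => by simp⟩

theorem locallyIntegrableOn_congr_ae {f f' : ℝ → ℝ} (h : LocallyIntegrableOn f (Ioo 0 1))
    (e : f =ᵐ[leb] f') : LocallyIntegrableOn f' (Ioo 0 1) := by
  intro x hx
  obtain ⟨t, ht, hi⟩ := h x hx
  refine ⟨t ∩ Ioo 0 1, inter_mem ht self_mem_nhdsWithin, ?_⟩
  exact (hi.mono_set inter_subset_left).congr_fun_ae
    (ae_restrict_of_ae_restrict_of_subset inter_subset_right e)

theorem HasWeakDeriv.congr {f f' g g' : ℝ → ℝ} (h : HasWeakDeriv f g)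
    (e : f =ᵐ[leb] f') (e' : g =ᵐ[leb] g') : HasWeakDeriv f' g' := by
  refine ⟨locallyIntegrableOn_congr_ae h.1 e, locallyIntegrableOn_congr_ae h.2.1 e',
    fun φ hφ => ?_⟩
  have h1 : ∫ x in Ioo (0 : ℝ) 1, f' x * _root_.deriv φ x
      = ∫ x in Ioo (0 : ℝ) 1, f x * _root_.deriv φ x :=
    integral_congr_ae (by filter_upwards [e] with x hx; rw [hx])
  have h2 : ∫ x in Ioo (0 : ℝ) 1, g' x * φ x = ∫ x in Ioo (0 : ℝ) 1, g x * φ x :=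
    integral_congr_ae (by filter_upwards [e'] with x hx; rw [hx])
  rw [h1, h2, h.2.2 φ hφ]

theorem hasWeakDeriv_weakDeriv {f : ℝ → ℝ} (h : ∃ g, HasWeakDeriv f g) :
    HasWeakDeriv f (weakDeriv f) := by
  rw [weakDeriv, dif_pos h]
  exact h.choose_spec

theorem HasWeakDeriv.weakDeriv_ae {f g : ℝ → ℝ} (h : HasWeakDeriv f g) :
    weakDeriv f =ᵐ[leb] g :=
  (hasWeakDeriv_weakDeriv ⟨g, h⟩).unique h

theorem IsTest.locallyIntegrableOn {φ : ℝ → ℝ} (h : IsTest φ) :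
    LocallyIntegrableOn φ (Ioo 0 1) :=
  h.1.continuous.locallyIntegrable.locallyIntegrableOn _

/-- A function with vanishing weak derivative is a.e. constant. -/
theorem HasWeakDeriv.ae_const {f : ℝ → ℝ} (h : HasWeakDeriv f 0) :
    ∃ c : ℝ, f =ᵐ[leb] fun _ => c := by
  let B : ContDiffBump (1 / 2 : ℝ) := ⟨1 / 8, 1 / 4, by norm_num, by norm_num⟩
  let ρ : ℝ → ℝ := B.normed volume
  have hρ1 : ContDiff ℝ ∞ ρ := B.contDiff_normed
  have hρ2 : HasCompactSupport ρ := B.hasCompactSupport_normed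
  have hρ3 : tsupport ρ ⊆ Ioo 0 1 := by
    rw [B.tsupport_normed_eq]
    intro x hx
    rw [Metric.mem_closedBall, Real.dist_eq, abs_le] at hx
    change -(1 / 4) ≤ _ ∧ _ ≤ (1 / 4 : ℝ) at hx
    constructor <;> linarith [hx.1, hx.2]
  have hρ : IsTest ρ := ⟨hρ1, hρ2, hρ3⟩
  have hρi : ∫ x, ρ x = 1 := B.integral_normed
  set c : ℝ := ∫ x in Ioo (0 : ℝ) 1, f x * ρ x with hc
  refine ⟨c, ?_⟩
  have key := ae_zero_of_test (f := fun x => f x - c)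
    (h.1.sub (locallyIntegrableOn_const c)) (fun ψ hψ => by
      set s : ℝ := ∫ x, ψ x with hs
      let θ : ℝ → ℝ := fun x => ψ x - s * ρ x
      have hθ1 : ContDiff ℝ ∞ θ := hψ.1.sub (contDiff_const.mul hρ1)
      have hθi : ∫ x, θ x = 0 := by
        have i1 : Integrable ψ := hψ.1.continuous.integrable_of_hasCompactSupport hψ.2.1
        have i2 : Integrable ρ := hρ1.continuous.integrable_of_hasCompactSupport hρ2
        have : ∫ x, θ x = (∫ x, ψ x) - ∫ x, s * ρ x := integral_sub i1 (i2.const_mul s)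
        rw [this, integral_const_mul, hρi, ← hs]; ring
      have hK : IsCompact (tsupport ψ ∪ tsupport ρ ∪ {1 / 2}) :=
        (hψ.2.1.isCompact.union hρ2.isCompact).union isCompact_singleton
      have hKne : (tsupport ψ ∪ tsupport ρ ∪ {1 / 2}).Nonempty := ⟨1 / 2, Or.inr rfl⟩
      have hKs : tsupport ψ ∪ tsupport ρ ∪ {1 / 2} ⊆ Ioo (0 : ℝ) 1 := by
        refine union_subset (union_subset hψ.2.2 hρ3) ?_
        rw [singleton_subset_iff]; constructor <;> norm_num
      obtain ⟨m, hm⟩ := hK.exists_isLeast hKne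
      obtain ⟨M, hM⟩ := hK.exists_isGreatest hKne
      have hm0 : 0 < m := (hKs hm.1).1
      have hM1 : M < 1 := (hKs hM.1).2
      have hθs : ∀ x, θ x ≠ 0 → m ≤ x ∧ x ≤ M := by
        intro x hx
        have : x ∈ tsupport ψ ∪ tsupport ρ ∪ {1 / 2} := by
          left
          by_contra hcon
          rw [mem_union, not_or] at hcon
          apply hx
          change ψ x - s * ρ x = 0
          rw [image_eq_zero_of_notMem_tsupport hcon.1, image_eq_zero_of_notMem_tsupport hcon.2]
          ring
        exact ⟨hm.2 this, hM.2 this⟩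
      let φ : ℝ → ℝ := fun x => ∫ t in (0 : ℝ)..x, θ t
      have hd : ∀ x, HasDerivAt φ (θ x) x := fun x =>
        intervalIntegral.integral_hasDerivAt_right
          (hθ1.continuous.intervalIntegrable _ _)
          (hθ1.continuous.stronglyMeasurableAtFilter _ _) hθ1.continuous.continuousAt
      have hde : _root_.deriv φ = θ := funext fun x => (hd x).deriv
      have hφ1 : ContDiff ℝ ∞ φ :=
        contDiff_infty_iff_deriv.2 ⟨fun x => (hd x).differentiableAt, by rw [hde]; exact hθ1⟩
      have hφs : Function.support φ ⊆ Icc m M := by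
        intro x hx
        by_contra hcon
        apply hx
        rw [mem_Icc, not_and_or, not_le, not_le] at hcon
        rcases hcon with hlt | hgt
        · change ∫ t in (0 : ℝ)..x, θ t = 0
          rw [intervalIntegral.integral_congr (g := fun _ => 0), intervalIntegral.integral_zero]
          intro t ht
          by_contra h0
          have h1 := (hθs t h0).1
          rw [mem_uIcc] at ht
          rcases ht with ht | ht <;> linarith [ht.1, ht.2]
        · change ∫ t in (0 : ℝ)..x, θ t = 0
          rw [intervalIntegral.integral_eq_integral_of_support_subset, hθi]
          intro t ht
          have h1 := hθs t ht
          exact ⟨by linarith [h1.1], by linarith [h1.2]⟩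
      have hφt : tsupport φ ⊆ Icc m M := closure_minimal hφs isClosed_Icc
      have hφ : IsTest φ := ⟨hφ1, isCompact_Icc.of_isClosed_subset (isClosed_tsupport _) hφt,
        hφt.trans fun x hx => ⟨by linarith [hx.1], by linarith [hx.2]⟩⟩
      have h0 := h.2.2 φ hφ
      rw [hde] at h0
      have i1 := integrable_mul_test h.1 hψ
      have i2 := integrable_mul_test h.1 hρ
      have e1 : ∫ x in Ioo (0 : ℝ) 1, f x * θ x
          = (∫ x in Ioo (0 : ℝ) 1, f x * ψ x) - s * c := by
        rw [hc, ← integral_const_mul, ← integral_sub i1 (i2.const_mul s)]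
        exact integral_congr_ae (Eventually.of_forall fun x => by
          change f x * (ψ x - s * ρ x) = _; ring)
      have e2 : ∫ x in Ioo (0 : ℝ) 1, (f x - c) * ψ x
          = (∫ x in Ioo (0 : ℝ) 1, f x * ψ x) - c * s := by
        have e3 : s = ∫ x in Ioo (0 : ℝ) 1, ψ x := by
          rw [hs, setIntegral_eq_integral_of_forall_compl_eq_zero]
          intro x hx
          exact image_eq_zero_of_notMem_tsupport fun h' => hx (hψ.2.2 h')
        have i3 : Integrable ψ leb :=
          (hψ.1.continuous.integrable_of_hasCompactSupport hψ.2.1).integrableOn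
        rw [e3, ← integral_const_mul, ← integral_sub i1 (i3.const_mul c)]
        exact integral_congr_ae (Eventually.of_forall fun x => by ring)
      rw [e1] at h0
      rw [e2]
      simp at h0
      linarith)
  filter_upwards [key] with x hx
  simpa [sub_eq_zero] using hx

/-! ### The spaces `H¹_{1/σ,0}(0,1)` and `H²_{1/σ,0}(0,1)` -/

/-- A continuous function on `[0,1]`, viewed as a function on `ℝ`. -/
def ext (u : C(Icc (0 : ℝ) 1, ℝ)) (x : ℝ) : ℝ := u (projIcc 0 1 zero_le_one x)

theorem ext_add (u v : C(Icc (0 : ℝ) 1, ℝ)) : ext (u + v) = ext u + ext v := rfl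
theorem ext_smul (c : ℝ) (u : C(Icc (0 : ℝ) 1, ℝ)) : ext (c • u) = c • ext u := rfl
theorem ext_zero : ext (0 : C(Icc (0 : ℝ) 1, ℝ)) = 0 := rfl
theorem continuous_ext (u : C(Icc (0 : ℝ) 1, ℝ)) : Continuous (ext u) :=
  u.continuous.comp continuous_projIcc

theorem ae_w_of_ae {a b : ℝ → ℝ} {p : ℝ → Prop} (h : ∀ᵐ x ∂leb, p x) :
    ∀ᵐ x ∂(wMeasure a b), p x :=
  (withDensity_absolutelyContinuous _ _).ae_le h

/-- The subspace `H¹_{1/σ,0}(0,1)` of `C[0,1]`, consisting of all `u ∈ H¹(0,1) ∩ L²_{1/σ}(0,1)` with `u(0) = 0`. An element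
of `H¹(0,1)` is identified with its continuous representative on `[0,1]`. -/
def H1sub (a b : ℝ → ℝ) : Submodule ℝ C(Icc (0 : ℝ) 1, ℝ) where
  carrier := {u | (∃ g, HasWeakDeriv (ext u) g ∧ MemLp g 2 leb) ∧
    MemLp (ext u) 2 (wMeasure a b) ∧ u 0 = 0}
  add_mem' := by
    rintro u v ⟨⟨g, hg, hg'⟩, hu, hu0⟩ ⟨⟨k, hk, hk'⟩, hv, hv0⟩
    exact ⟨⟨g + k, hg.add hk, hg'.add hk'⟩, hu.add hv, by simp [hu0, hv0]⟩
  zero_mem' := ⟨⟨0, hasWeakDeriv_zero, MemLp.zero⟩, MemLp.zero, rfl⟩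
  smul_mem' := by
    rintro c u ⟨⟨g, hg, hg'⟩, hu, hu0⟩
    exact ⟨⟨c • g, hg.smul c, hg'.const_smul c⟩, hu.const_smul c, by simp [hu0]⟩

/-- The space `H¹_{1/σ,0}(0,1)` as a type. -/
abbrev H1 (a b : ℝ → ℝ) : Type := H1sub a b

variable {a b : ℝ → ℝ}

/-- The (weak) derivative `u'` of `u ∈ H¹_{1/σ,0}(0,1)`. -/
def H1.d (u : H1 a b) : ℝ → ℝ := weakDeriv (ext u.1)

/-- The value `u(1)` of `u ∈ H¹_{1/σ,0}(0,1)`. -/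
def H1.one (u : H1 a b) : ℝ := u.1 1

theorem H1.hasWeakDeriv (u : H1 a b) : HasWeakDeriv (ext u.1) u.d :=
  hasWeakDeriv_weakDeriv (u.2.1.imp fun _ h => h.1)

theorem H1.memLp_d (u : H1 a b) : MemLp u.d 2 leb := by
  obtain ⟨g, hg, hg'⟩ := u.2.1
  exact (memLp_congr_ae hg.weakDeriv_ae).2 hg'

theorem H1.d_add (u v : H1 a b) : (u + v).d =ᵐ[leb] u.d + v.d :=
  HasWeakDeriv.weakDeriv_ae (u.hasWeakDeriv.add v.hasWeakDeriv)

theorem H1.d_smul (c : ℝ) (u : H1 a b) : (c • u).d =ᵐ[leb] c • u.d :=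
  HasWeakDeriv.weakDeriv_ae (u.hasWeakDeriv.smul c)

theorem H1.d_zero : (0 : H1 a b).d =ᵐ[leb] 0 :=
  HasWeakDeriv.weakDeriv_ae hasWeakDeriv_zero

/-- The inclusion of `H¹_{1/σ,0}(0,1)` into `L²_{1/σ}(0,1)`. -/
def H1.toL2 : H1 a b →ₗ[ℝ] L2w a b where
  toFun u := u.2.2.1.toLp (ext u.1)
  map_add' _ _ := rfl
  map_smul' _ _ := rfl

/-- The second weak derivative `u''` of `u`. -/
def H1.dd (u : H1 a b) : ℝ → ℝ := weakDeriv u.d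

/-- The space `H²_{1/σ,0}(0,1) = D(A)` of all `u ∈ H¹_{1/σ,0}(0,1)` for which `u''` exists as a
locally integrable function on `(0,1)` and `a u'' + b u' ∈ L²_{1/σ}(0,1)`. -/
def H2 (a b : ℝ → ℝ) : Submodule ℝ (H1 a b) where
  carrier := {u | (∃ g, HasWeakDeriv u.d g) ∧
    MemLp (fun x => a x * u.dd x + b x * u.d x) 2 (wMeasure a b)}
  add_mem' := by
    rintro u v ⟨hu, hu'⟩ ⟨hv, hv'⟩
    have h := ((hasWeakDeriv_weakDeriv hu).add (hasWeakDeriv_weakDeriv hv)).congr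
      (H1.d_add u v).symm (EventuallyEq.refl _ _)
    refine ⟨⟨_, h⟩, (memLp_congr_ae (ae_w_of_ae ?_)).2 (hu'.add hv')⟩
    filter_upwards [h.weakDeriv_ae, H1.d_add u v] with x h1 h2
    simp only [H1.dd, Pi.add_apply] at h1 h2 ⊢
    rw [h1, h2]; ring
  zero_mem' := by
    have h := (hasWeakDeriv_zero).congr (H1.d_zero (a := a) (b := b)).symm
      (EventuallyEq.refl _ _)
    refine ⟨⟨_, h⟩, (memLp_congr_ae (ae_w_of_ae ?_)).2 MemLp.zero⟩
    filter_upwards [h.weakDeriv_ae, H1.d_zero (a := a) (b := b)] with x h1 h2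
    simp only [H1.dd, Pi.zero_apply] at h1 h2 ⊢
    rw [h1, h2]; ring
  smul_mem' := by
    rintro c u ⟨hu, hu'⟩
    have h := ((hasWeakDeriv_weakDeriv hu).smul c).congr
      (H1.d_smul c u).symm (EventuallyEq.refl _ _)
    refine ⟨⟨_, h⟩, (memLp_congr_ae (ae_w_of_ae ?_)).2 (hu'.const_smul c)⟩
    filter_upwards [h.weakDeriv_ae, H1.d_smul c u] with x h1 h2
    simp only [H1.dd, Pi.smul_apply, smul_eq_mul] at h1 h2 ⊢
    rw [h1, h2]; ring

/-- The operator `A u = a u'' + b u'` with domain `D(A) = H²_{1/σ,0}(0,1)`, valued in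
`L²_{1/σ}(0,1)`. -/
def opA (a b : ℝ → ℝ) : H2 a b →ₗ[ℝ] L2w a b where
  toFun u := u.2.2.toLp (fun x => a x * u.1.dd x + b x * u.1.d x)
  map_add' := by
    rintro ⟨u, hu, hu'⟩ ⟨v, hv, hv'⟩
    have h := ((hasWeakDeriv_weakDeriv hu).add (hasWeakDeriv_weakDeriv hv)).congr
      (H1.d_add u v).symm (EventuallyEq.refl _ _)
    rw [← MemLp.toLp_add, MemLp.toLp_eq_toLp_iff]
    apply ae_w_of_ae
    filter_upwards [h.weakDeriv_ae, H1.d_add u v] with x h1 h2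
    simp only [H1.dd, Pi.add_apply, Submodule.coe_add] at h1 h2 ⊢
    rw [h1, h2]; ring
  map_smul' := by
    rintro c ⟨u, hu, hu'⟩
    have h := ((hasWeakDeriv_weakDeriv hu).smul c).congr
      (H1.d_smul c u).symm (EventuallyEq.refl _ _)
    rw [RingHom.id_apply, ← MemLp.toLp_const_smul, MemLp.toLp_eq_toLp_iff]
    apply ae_w_of_ae
    filter_upwards [h.weakDeriv_ae, H1.d_smul c u] with x h1 h2
    simp only [H1.dd, Pi.smul_apply, smul_eq_mul, Submodule.coe_smul] at h1 h2 ⊢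
    rw [h1, h2]; ring

/-- `c` is the value at `1` of (the representative continuous on `(0,1]` of) `f`. -/
def HasValueAtOne (f : ℝ → ℝ) (c : ℝ) : Prop :=
  ∃ p : ℝ → ℝ, ContinuousOn p (Ioc 0 1) ∧ p =ᵐ[leb] f ∧ p 1 = c

/-- The pairs `(u, v) ∈ H²_{1/σ,0} × H¹_{1/σ,0}` with `(η u')(1) + v(1) + β u(1) = 0`. -/
def bcPairs (a b : ℝ → ℝ) (β : ℝ) : Submodule ℝ (H2 a b × H1 a b) where
  carrier := {Y | ∃ c : ℝ, HasValueAtOne (fun x => eta a b x * Y.1.1.d x) c ∧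
    c + Y.2.one + β * Y.1.1.one = 0}
  add_mem' := by
    rintro ⟨u, v⟩ ⟨u', v'⟩ ⟨c, ⟨p, hp, hpe, hp1⟩, hc⟩ ⟨c', ⟨p', hp', hpe', hp1'⟩, hc'⟩
    refine ⟨c + c', ⟨p + p', hp.add hp', ?_, by simp [hp1, hp1']⟩, ?_⟩
    · filter_upwards [hpe, hpe', H1.d_add u.1 u'.1] with x h1 h2 h3
      simp only [Pi.add_apply, Prod.fst_add, Submodule.coe_add] at h1 h2 h3 ⊢
      rw [h1, h2, h3]; ring
    · have e1 : (v + v').one = v.one + v'.one := rfl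
      have e2 : (u + u').1.one = u.1.one + u'.1.one := rfl
      simp only [Prod.snd_add, Prod.fst_add, e1, e2] at hc hc' ⊢
      linarith
  zero_mem' := by
    refine ⟨0, ⟨0, continuousOn_const, ?_, rfl⟩, ?_⟩
    · filter_upwards [H1.d_zero (a := a) (b := b)] with x h
      simp only [Pi.zero_apply, Prod.fst_zero, Submodule.coe_zero] at h ⊢
      rw [h, mul_zero]
    · have e : (0 : H1 a b).one = 0 := rfl
      simp [e]
  smul_mem' := by
    rintro r ⟨u, v⟩ ⟨c, ⟨p, hp, hpe, hp1⟩, hc⟩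
    refine ⟨r * c, ⟨r • p, hp.const_smul r, ?_, by simp [hp1]⟩, ?_⟩
    · filter_upwards [hpe, H1.d_smul r u.1] with x h1 h3
      simp only [Pi.smul_apply, Prod.smul_fst, Submodule.coe_smul, smul_eq_mul] at h1 h3 ⊢
      rw [h1, h3]; ring
    · have e1 : (r • v).one = r * v.one := rfl
      have e2 : (r • u).1.one = r * u.1.one := rfl
      simp only [Prod.smul_snd, Prod.smul_fst, e1, e2] at hc ⊢
      linear_combination r * hc

/-! ### The energy space -/

/-- The space `H₀ = H¹_{1/σ,0}(0,1) × L²_{1/σ}(0,1)`; its inner product is defined below. -/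
def EnergySpace {a b : ℝ → ℝ} {β : ℝ} (_hab : Admissible a b) (_hβ : 0 ≤ β) : Type :=
  H1 a b × L2w a b


variable {β : ℝ}

instance (hab : Admissible a b) (hβ : 0 ≤ β) : AddCommGroup (EnergySpace hab hβ) :=
  inferInstanceAs (AddCommGroup (H1 a b × L2w a b))

instance (hab : Admissible a b) (hβ : 0 ≤ β) : Module ℝ (EnergySpace hab hβ) :=
  inferInstanceAs (Module ℝ (H1 a b × L2w a b))

/-- Pair `(u, v)` as an element of the energy space. -/
def EnergySpace.mk (hab : Admissible a b) (hβ : 0 ≤ β) (u : H1 a b) (v : L2w a b) :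
    EnergySpace hab hβ := (u, v)

theorem Admissible.intervalIntegrable (hab : Admissible a b) {x y : ℝ}
    (hx : x ∈ Icc (0 : ℝ) 1) (hy : y ∈ Icc (0 : ℝ) 1) :
    IntervalIntegrable (fun s => b s / a s) volume x y := by
  have h : IntervalIntegrable (fun s => b s / a s) volume 0 1 := by
    rw [intervalIntegrable_iff_integrableOn_Ioo_of_le zero_le_one]
    exact hab.integrable_div
  refine h.mono_set ?_
  rw [uIcc_of_le (zero_le_one (α := ℝ))]
  exact uIcc_subset_Icc hx hy

theorem Admissible.continuousOn_eta (hab : Admissible a b) :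
    ContinuousOn (eta a b) (Icc 0 1) := by
  have h2 : ContinuousOn (fun x => ∫ s in (0 : ℝ)..x, b s / a s) (Icc 0 1) := by
    have := intervalIntegral.continuousOn_primitive_interval (a := 0) (b := 1) (μ := volume)
      (f := fun s => b s / a s) (by
        rw [uIcc_of_le (zero_le_one (α := ℝ)), integrableOn_Icc_iff_integrableOn_Ioo]
        exact hab.integrable_div)
    rwa [uIcc_of_le (zero_le_one (α := ℝ))] at this
  have h3 : ContinuousOn (fun x => Real.exp ((∫ s in (1 / 2 : ℝ)..0, b s / a s)
      + ∫ s in (0 : ℝ)..x, b s / a s)) (Icc 0 1) :=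
    Real.continuous_exp.comp_continuousOn (continuousOn_const.add h2)
  refine h3.congr fun x hx => ?_
  simp only [eta]
  rw [intervalIntegral.integral_add_adjacent_intervals]
  · exact hab.intervalIntegrable (by constructor <;> norm_num) (by simp)
  · exact hab.intervalIntegrable (by simp) hx

theorem eta_pos (a b : ℝ → ℝ) (x : ℝ) : 0 < eta a b x := Real.exp_pos _

theorem Admissible.exists_eta_le (hab : Admissible a b) :
    ∃ C : ℝ, ∀ x ∈ Icc (0 : ℝ) 1, ‖eta a b x‖ ≤ C :=
  isCompact_Icc.exists_bound_of_continuousOn hab.continuousOn_eta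

theorem Admissible.integrable_eta_mul (hab : Admissible a b) {f g : ℝ → ℝ}
    (hf : MemLp f 2 leb) (hg : MemLp g 2 leb) :
    Integrable (fun x => eta a b x * (f x * g x)) leb := by
  obtain ⟨C, hC⟩ := hab.exists_eta_le
  refine (hf.integrable_mul hg).bdd_mul (c := C) ?_ ?_
  · exact (hab.continuousOn_eta.mono Ioo_subset_Icc_self).aestronglyMeasurable measurableSet_Ioo
  · filter_upwards [ae_restrict_mem measurableSet_Ioo] with x hx
    exact hC x (Ioo_subset_Icc_self hx)

theorem Admissible.ae_of_ae_w (hab : Admissible a b) {p : ℝ → Prop}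
    (h : ∀ᵐ x ∂(wMeasure a b), p x) : ∀ᵐ x ∂leb, p x := by
  refine (withDensity_absolutelyContinuous' ?_ ?_).ae_le h
  · have h1 : ContinuousOn (fun x => 1 / sigma a b x) (Ioo 0 1) := by
      have ha := hab.continuousOn_a.mono Ioo_subset_Icc_self
      have he := hab.continuousOn_eta.mono Ioo_subset_Icc_self
      exact continuousOn_const.div (ha.div he fun x _ => (eta_pos a b x).ne')
        fun x hx => (div_pos (hab.a_pos x ⟨hx.1, hx.2.le⟩) (eta_pos a b x)).ne'
    exact (h1.aemeasurable measurableSet_Ioo).ennreal_ofReal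
  · filter_upwards [ae_restrict_mem measurableSet_Ioo] with x hx
    rw [Ne, ENNReal.ofReal_eq_zero, not_le]
    exact one_div_pos.2 (div_pos (hab.a_pos x ⟨hx.1, hx.2.le⟩) (eta_pos a b x))

theorem eq_of_ae_eq {u : C(Icc (0 : ℝ) 1, ℝ)} {g : ℝ → ℝ} (hg : Continuous g)
    (h : ext u =ᵐ[leb] g) (x : Icc (0 : ℝ) 1) : u x = g x := by
  have h1 : EqOn (ext u) g (Ioo 0 1) :=
    Measure.eqOn_open_of_ae_eq h isOpen_Ioo (continuous_ext u).continuousOn hg.continuousOn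
  have h2 := h1.closure (continuous_ext u) hg
  rw [closure_Ioo (zero_ne_one)] at h2
  have := h2 x.2
  rwa [ext, projIcc_val] at this

theorem H1.eq_zero_of_d_ae_zero {u : H1 a b} (h : u.d =ᵐ[leb] 0) : u = 0 := by
  obtain ⟨c, hc⟩ := (u.hasWeakDeriv.congr (EventuallyEq.refl _ _) h).ae_const
  have h1 := eq_of_ae_eq (u := u.1) continuous_const hc
  have h0 : c = 0 := (h1 0).symm.trans u.2.2.2
  ext x
  rw [h1 x, h0]
  rfl

theorem H1.toL2_injective (hab : Admissible a b) :
    Function.Injective (H1.toL2 : H1 a b →ₗ[ℝ] L2w a b) := by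
  intro u v huv
  have h1 : ext u.1 =ᵐ[wMeasure a b] ext v.1 := 
    (MemLp.toLp_eq_toLp_iff u.2.2.1 v.2.2.1).1 huv
  have h2 : ext u.1 =ᵐ[leb] ext v.1 := hab.ae_of_ae_w h1
  ext x
  rw [eq_of_ae_eq (continuous_ext v.1) h2 x, ext, projIcc_val]

/-- The inner product `⟨(u,v),(ũ,ṽ)⟩ = ∫₀¹ η u' ũ' + ∫₀¹ v ṽ / σ + β u(1) ũ(1)`. -/
@[reducible] def EnergySpace.core (hab : Admissible a b) (hβ : 0 ≤ β) :
    InnerProductSpace.Core ℝ (EnergySpace hab hβ) where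
  inner Y Z := (∫ x in Ioo (0 : ℝ) 1, eta a b x * (Y.1.d x * Z.1.d x)) + ⟪Y.2, Z.2⟫_ℝ
    + β * (Y.1.one * Z.1.one)
  conj_inner_symm Y Z := by
    simp only [conj_trivial]
    rw [real_inner_comm, mul_comm Z.1.one]
    simp only [mul_comm (Z.1.d _)]
  re_inner_nonneg Y := by
    rw [RCLike.re_to_real]
    have h1 : 0 ≤ ∫ x in Ioo (0 : ℝ) 1, eta a b x * (Y.1.d x * Y.1.d x) :=
      integral_nonneg fun x => mul_nonneg (eta_pos a b x).le (mul_self_nonneg _)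
    have h2 : 0 ≤ ⟪Y.2, Y.2⟫_ℝ := real_inner_self_nonneg
    have h3 := mul_nonneg hβ (mul_self_nonneg Y.1.one)
    linarith
  add_left X Y Z := by
    have e1 : (X + Y).1 = X.1 + Y.1 := rfl
    have e2 : (X + Y).2 = X.2 + Y.2 := rfl
    have e3 : (X.1 + Y.1).one = X.1.one + Y.1.one := rfl
    have e4 : ∫ x in Ioo (0 : ℝ) 1, eta a b x * ((X.1 + Y.1).d x * Z.1.d x)
        = (∫ x in Ioo (0 : ℝ) 1, eta a b x * (X.1.d x * Z.1.d x))
          + ∫ x in Ioo (0 : ℝ) 1, eta a b x * (Y.1.d x * Z.1.d x) := by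
      rw [← integral_add (hab.integrable_eta_mul X.1.memLp_d Z.1.memLp_d)
        (hab.integrable_eta_mul Y.1.memLp_d Z.1.memLp_d)]
      refine integral_congr_ae ?_
      filter_upwards [H1.d_add X.1 Y.1] with x hx
      rw [hx, Pi.add_apply]; ring
    rw [e1, e2, e3, e4, inner_add_left]
    ring
  smul_left X Y r := by
    have e1 : (r • X).1 = r • X.1 := rfl
    have e2 : (r • X).2 = r • X.2 := rfl
    have e3 : (r • X.1).one = r * X.1.one := rfl
    have e4 : ∫ x in Ioo (0 : ℝ) 1, eta a b x * ((r • X.1).d x * Y.1.d x)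
        = r * ∫ x in Ioo (0 : ℝ) 1, eta a b x * (X.1.d x * Y.1.d x) := by
      rw [← integral_const_mul]
      refine integral_congr_ae ?_
      filter_upwards [H1.d_smul r X.1] with x hx
      rw [hx, Pi.smul_apply, smul_eq_mul]; ring
    rw [e1, e2, e3, e4, real_inner_smul_left, conj_trivial]
    ring
  definite Y h := by
    have h1 : 0 ≤ ∫ x in Ioo (0 : ℝ) 1, eta a b x * (Y.1.d x * Y.1.d x) :=
      integral_nonneg fun x => mul_nonneg (eta_pos a b x).le (mul_self_nonneg _)
    have h2 : 0 ≤ ⟪Y.2, Y.2⟫_ℝ := real_inner_self_nonneg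
    have h3 := mul_nonneg hβ (mul_self_nonneg Y.1.one)
    have h4 : ∫ x in Ioo (0 : ℝ) 1, eta a b x * (Y.1.d x * Y.1.d x) = 0 := by linarith
    have h5 : ⟪Y.2, Y.2⟫_ℝ = 0 := by linarith
    rw [integral_eq_zero_iff_of_nonneg
      (fun x => mul_nonneg (eta_pos a b x).le (mul_self_nonneg _))
      (hab.integrable_eta_mul Y.1.memLp_d Y.1.memLp_d)] at h4
    refine Prod.ext (H1.eq_zero_of_d_ae_zero ?_) (inner_self_eq_zero.1 h5)
    filter_upwards [h4] with x hx
    simpa [(eta_pos a b x).ne'] using hx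

instance (hab : Admissible a b) (hβ : 0 ≤ β) : NormedAddCommGroup (EnergySpace hab hβ) :=
  (EnergySpace.core hab hβ).toNormedAddCommGroup

instance (hab : Admissible a b) (hβ : 0 ≤ β) : InnerProductSpace ℝ (EnergySpace hab hβ) :=
  InnerProductSpace.ofCore (EnergySpace.core hab hβ).toCore

/-! ### The wave operator -/

/-- The inclusion `(u, v) ↦ (u, v)` of `bcPairs` into `H₀`, whose range is `D(𝒜)`. -/
def bcInclusion (hab : Admissible a b) (hβ : 0 ≤ β) :
    bcPairs a b β →ₗ[ℝ] EnergySpace hab hβ where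
  toFun Y := EnergySpace.mk hab hβ Y.1.1.1 Y.1.2.toL2
  map_add' _ _ := rfl
  map_smul' _ _ := rfl

theorem bcInclusion_injective (hab : Admissible a b) (hβ : 0 ≤ β) :
    Function.Injective (bcInclusion hab hβ) := by
  intro Y Z h
  have h1 : Y.1.1.1 = Z.1.1.1 := congrArg Prod.fst h
  have h2 : Y.1.2.toL2 = Z.1.2.toL2 := congrArg Prod.snd h
  exact Subtype.ext (Prod.ext (Subtype.ext h1) (H1.toL2_injective hab h2))

/-- The formula `(u, v) ↦ (v, A u)`. -/
def bcAction (hab : Admissible a b) (hβ : 0 ≤ β) :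
    bcPairs a b β →ₗ[ℝ] EnergySpace hab hβ where
  toFun Y := EnergySpace.mk hab hβ Y.1.2 (opA a b Y.1.1)
  map_add' Y Z := Prod.ext rfl ((opA a b).map_add Y.1.1 Z.1.1)
  map_smul' c Y := Prod.ext rfl ((opA a b).map_smul c Y.1.1)

/-- The unbounded operator `𝒜 (u, v) = (v, A u)` on `H₀`, with domain
`D(𝒜) = {(u, v) ∈ H²_{1/σ,0} × H¹_{1/σ,0} : (η u')(1) + v(1) + β u(1) = 0}`. -/
def waveOperator (hab : Admissible a b) (hβ : 0 ≤ β) :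
    EnergySpace hab hβ →ₗ.[ℝ] EnergySpace hab hβ where
  domain := LinearMap.range (bcInclusion hab hβ)
  toFun := bcAction hab hβ ∘ₗ
    (LinearEquiv.ofInjective (bcInclusion hab hβ) (bcInclusion_injective hab hβ)).symm.toLinearMap

/-! ### Dissipative operators and contraction semigroups -/

/-- Dissipative (non-positive) operators on a real inner product space. -/
def IsDissipative {H : Type*} [NormedAddCommGroup H] [InnerProductSpace ℝ H]
    (T : H →ₗ.[ℝ] H) : Prop :=
  ∀ x : T.domain, ⟪T x, (x : H)⟫_ℝ ≤ 0

/-- `S` is a strongly continuous semigroup of linear contractions on `H`. -/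
structure IsContractionSemigroup {H : Type*} [NormedAddCommGroup H] [NormedSpace ℝ H]
    (S : ℝ≥0 → H →L[ℝ] H) : Prop where
  zero : S 0 = ContinuousLinearMap.id ℝ H
  add : ∀ s t, S (s + t) = (S s).comp (S t)
  contraction : ∀ t x, ‖S t x‖ ≤ ‖x‖
  continuous : ∀ x, Continuous fun t => S t x

/-- `T` is the generator of `S`: `x ∈ D(T)` and `T x = y` if and only if
`(S(t) x - x) / t → y` as `t → 0⁺`. -/
def IsGenerator {H : Type*} [NormedAddCommGroup H] [NormedSpace ℝ H]
    (T : H →ₗ.[ℝ] H) (S : ℝ≥0 → H →L[ℝ] H) : Prop :=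
  ∀ x y : H, (x, y) ∈ T.graph ↔
    Tendsto (fun t : ℝ≥0 => (t : ℝ)⁻¹ • (S t x - x)) (𝓝[>] 0) (𝓝 y)

end

end DegenerateWave

/-! Dissipativity is Green's formula. With `η' = η b/a` one has `Au/σ = (ηu')'`, so testing against
`v` and inserting the boundary condition gives `⟨𝒜(u,v),(u,v)⟩₁ = ((ηu')(1) + βu(1)) v(1) = -v(1)²`.
The boundary term at `0` vanishes because `ηu'` is in `L²` while `|v(x)| ≤ √x ‖v'‖`: a nonzero limit
of the product would make `1/x` integrable near `0` (`eq_zero_of_tendsto_mul`, `Admissible.green`).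

The difficulty is that the energy norm does not control `∫u²/σ`, so `𝓗₀` need not be complete and
the Lumer–Phillips theorem does not apply to it directly. Adding `∫u²/σ` to the squared norm
produces a finer Hilbert space `X` on the same vectors; completeness is that of `FormDomain`. In `X`
the operator is only quasi-dissipative: the extra term `∫vu/σ` is at most `‖(u,v)‖²`, so `𝒜 - 1` is
dissipative there (`inner_finer_le`).

For `l ≥ 1` the equation `(l - 𝒜)(u,v) = (f,g)` reduces, by `v = lu - f`, to `l²u - Au = g + lf`
with a Robin condition at `1`. Lax–Milgram on `FormDomain` solves it weakly, and `exists_h2_of_weak`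
recovers both `Au` and the boundary value.

Hence `𝒜 - 1` is maximal dissipative in `X`. Yosida approximation
(`IsMaxDissipative.exists_semigroup`) gives a contraction semigroup `S` on `X`, and its domain is
dense in `X`, hence in `𝓗₀`. The rescaled family `eᵗS(t)` contracts the coarse energy norm: along
orbits in the domain the derivative of the squared norm is twice `⟨𝒜Y,Y⟩₁ ≤ 0`, and density does the
rest. Its generator contains `𝒜`, and is no larger because `l - 𝒜` is onto for some `l > 0`
(`IsContractionSemigroup.mem_of_tendsto`). This transfer is `exists_generator_of_finer_hilbert`. -/

namespace DegenerateWave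

noncomputable section

section Semigroup

variable {X : Type*} [NormedAddCommGroup X] [InnerProductSpace ℝ X]

/-! ### Exponentials of bounded dissipative operators -/

section Exponential

theorem exp_smul_apply_comm {A B : X →L[ℝ] X} (h : Commute A B) (t : ℝ) (x : X) :
    B (NormedSpace.exp (t • A) x) = NormedSpace.exp (t • A) (B x) :=
  congrArg (fun T : X →L[ℝ] X => T x) ((h.smul_left t).exp_left.eq.symm)

variable [CompleteSpace X]

theorem hasDerivAt_exp_smul_apply (A : X →L[ℝ] X) (x : X) (t : ℝ) :
    HasDerivAt (fun s : ℝ => NormedSpace.exp (s • A) x) (NormedSpace.exp (t • A) (A x)) t :=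
  (hasDerivAt_exp_smul_const A t).clm_apply (hasDerivAt_const t x) |>.congr_deriv (by simp)

/-- The derivative of `‖exp(sA)x‖²` is `2⟪A exp(sA)x, exp(sA)x⟫ ≤ 0`. -/
theorem norm_exp_smul_apply_le {A : X →L[ℝ] X} (hA : ∀ x, ⟪A x, x⟫_ℝ ≤ 0) {t : ℝ} (ht : 0 ≤ t)
    (x : X) : ‖NormedSpace.exp (t • A) x‖ ≤ ‖x‖ := by
  have hd : ∀ s : ℝ, HasDerivAt (fun s : ℝ => ‖NormedSpace.exp (s • A) x‖ ^ 2)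
      (2 * ⟪NormedSpace.exp (s • A) x, NormedSpace.exp (s • A) (A x)⟫_ℝ) s := fun s =>
    (hasDerivAt_exp_smul_apply A x s).norm_sq
  have hanti : Antitone fun s : ℝ => ‖NormedSpace.exp (s • A) x‖ ^ 2 := by
    refine antitone_of_deriv_nonpos (fun s => (hd s).differentiableAt) fun s => ?_
    rw [(hd s).deriv, ← exp_smul_apply_comm (Commute.refl A), real_inner_comm]
    linarith [hA (NormedSpace.exp (s • A) x)]
  have := hanti ht
  simp only [zero_smul, NormedSpace.exp_zero, one_apply_eq_self] at this
  exact le_of_sq_le_sq this (norm_nonneg _)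

/-- The curve `s ↦ exp(sA) exp((t-s)B) x` joins `exp(tB)x` to `exp(tA)x`. By commutation its
velocity is `exp(sA) exp((t-s)B)(Ax - Bx)`, of norm at most `‖Ax - Bx‖`. -/
theorem norm_exp_smul_sub_exp_smul_le {A B : X →L[ℝ] X} (hA : ∀ x, ⟪A x, x⟫_ℝ ≤ 0)
    (hB : ∀ x, ⟪B x, x⟫_ℝ ≤ 0) (hAB : Commute A B) {t : ℝ} (ht : 0 ≤ t) (x : X) :
    ‖NormedSpace.exp (t • A) x - NormedSpace.exp (t • B) x‖ ≤ t * ‖A x - B x‖ := by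
  have hd : ∀ s ∈ Icc 0 t, HasDerivWithinAt
      (fun s : ℝ => NormedSpace.exp (s • A) (NormedSpace.exp ((t - s) • B) x))
      (NormedSpace.exp (s • A) (NormedSpace.exp ((t - s) • B) (A x - B x))) (Icc 0 t) s := by
    intro s _
    have h1 := hasDerivAt_exp_smul_const A s
    have h2 : HasDerivAt (fun s : ℝ => NormedSpace.exp ((t - s) • B) x)
        (-(NormedSpace.exp ((t - s) • B) (B x))) s := by
      have := (hasDerivAt_exp_smul_apply B x (t - s)).scomp s ((hasDerivAt_id s).const_sub t)
      simpa [Function.comp_def] using this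
    refine ((h1.clm_apply h2).congr_deriv ?_).hasDerivWithinAt
    rw [map_neg, map_sub, map_sub, mul_apply_eq_comp,
      exp_smul_apply_comm hAB.symm, ← sub_eq_add_neg]
  have := norm_image_sub_le_of_norm_deriv_le_segment' hd (C := ‖A x - B x‖)
    (fun s hs => (norm_exp_smul_apply_le hA hs.1 _).trans
      (norm_exp_smul_apply_le hB (sub_nonneg.2 hs.2.le) _)) t ⟨ht, le_rfl⟩
  simpa [mul_comm] using this

theorem norm_exp_smul_sub_self_le {A : X →L[ℝ] X} (hA : ∀ x, ⟪A x, x⟫_ℝ ≤ 0) {t : ℝ}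
    (ht : 0 ≤ t) (x : X) : ‖NormedSpace.exp (t • A) x - x‖ ≤ t * ‖A x‖ := by
  simpa using norm_exp_smul_sub_exp_smul_le hA (B := 0) (by simp) (Commute.zero_right A) ht x

/-- First-order remainder with a constant that does not involve `‖A‖`, so that it survives the limit
along Yosida approximations. The velocity splits as `exp(sA)(Ax - y) + (exp(sA)y - y)`. -/
theorem norm_exp_smul_sub_self_sub_le {A : X →L[ℝ] X} (hA : ∀ x, ⟪A x, x⟫_ℝ ≤ 0) {t : ℝ}
    (ht : 0 ≤ t) (x y : X) {C : ℝ}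
    (hC : ∀ s ∈ Icc 0 t, ‖NormedSpace.exp (s • A) y - y‖ ≤ C) :
    ‖NormedSpace.exp (t • A) x - x - t • y‖ ≤ t * (‖A x - y‖ + C) := by
  have hd : ∀ s ∈ Icc 0 t, HasDerivWithinAt
      (fun s : ℝ => NormedSpace.exp (s • A) x - s • y)
      (NormedSpace.exp (s • A) (A x) - y) (Icc 0 t) s := fun s _ =>
    ((hasDerivAt_exp_smul_apply A x s).sub (by simpa using (hasDerivAt_id s).smul_const y)
      ).hasDerivWithinAt
  have := norm_image_sub_le_of_norm_deriv_le_segment' hd (C := ‖A x - y‖ + C)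
    (fun s hs => by
      have e : NormedSpace.exp (s • A) (A x) - y
          = NormedSpace.exp (s • A) (A x - y) + (NormedSpace.exp (s • A) y - y) := by
        rw [map_sub]; abel
      rw [e]
      exact (norm_add_le _ _).trans
        (add_le_add (norm_exp_smul_apply_le hA hs.1 _) (hC s ⟨hs.1, hs.2.le⟩))) t ⟨ht, le_rfl⟩
  simp only [zero_smul, NormedSpace.exp_zero, one_apply_eq_self, sub_zero] at this
  rw [sub_right_comm, mul_comm]
  exact this

end Exponential

/-! ### Maximal dissipative relations and their resolvents -/

/-- A linear relation `G` on `X` that is single-valued, dissipative and such that `l - G` is onto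
for all `l > 0`. -/
structure IsMaxDissipative (G : Submodule ℝ (X × X)) : Prop where
  inner_nonpos : ∀ x y, (x, y) ∈ G → ⟪y, x⟫_ℝ ≤ 0
  eq_zero : ∀ y, (0, y) ∈ G → y = 0
  exists_sub_eq : ∀ l : ℝ, 0 < l → ∀ z, ∃ x y, (x, y) ∈ G ∧ l • x - y = z

namespace IsMaxDissipative

variable {G : Submodule ℝ (X × X)}

/-- Pair `l x - y` with `x` and apply Cauchy–Schwarz. -/
theorem norm_le (hG : IsMaxDissipative G) (l : ℝ) {x y : X}
    (h : (x, y) ∈ G) : l * ‖x‖ ≤ ‖l • x - y‖ := by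
  rcases (norm_nonneg x).eq_or_lt with h0 | h0
  · simp [← h0]
  have h1 : l * ‖x‖ ^ 2 ≤ ⟪l • x - y, x⟫_ℝ := by
    rw [inner_sub_left, real_inner_smul_left, real_inner_self_eq_norm_sq]
    linarith [hG.inner_nonpos x y h]
  have h2 := h1.trans (real_inner_le_norm _ _)
  refine le_of_mul_le_mul_right ?_ h0
  linarith

/-- By `norm_le` the equation `l x - y = z` has only one solution `(x, y)` in `G`; uniqueness makes
any choice of solutions linear, and the same estimate bounds it by `1/l`. -/
theorem exists_resolvent (hG : IsMaxDissipative G) {l : ℝ} (hl : 0 < l) :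
    ∃ J : X →L[ℝ] X, (∀ z, (J z, l • J z - z) ∈ G) ∧
      ∀ x y, (x, y) ∈ G → J (l • x - y) = x := by
  choose f g hfg e using hG.exists_sub_eq l hl
  have huniq : ∀ x y, (x, y) ∈ G → f (l • x - y) = x := by
    intro x y h
    have h1 := G.sub_mem (hfg (l • x - y)) h
    have h2 := hG.norm_le l h1
    have h3 : l • (f (l • x - y) - x) - (g (l • x - y) - y) = 0 := by
      have := e (l • x - y)
      rw [smul_sub, sub_sub_sub_comm, this, sub_self]
    change l * ‖f (l • x - y) - x‖ ≤ ‖l • (f (l • x - y) - x) - (g (l • x - y) - y)‖ at h2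
    rw [h3, norm_zero] at h2
    have h4 : ‖f (l • x - y) - x‖ ≤ 0 := by
      by_contra hc
      exact absurd h2 (not_le.2 (mul_pos hl (not_le.1 hc)))
    exact sub_eq_zero.1 (norm_le_zero_iff.1 h4)
  have hg : ∀ z, g z = l • f z - z := fun z => by
    rw [eq_sub_iff_add_eq, ← eq_sub_iff_add_eq', e z]
  let J : X →ₗ[ℝ] X :=
    { toFun := f
      map_add' := fun z w => by
        have := huniq _ _ (G.add_mem (hfg z) (hfg w))
        change f (l • (f z + f w) - (g z + g w)) = f z + f w at this
        rwa [smul_add, add_sub_add_comm, e z, e w] at this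
      map_smul' := fun c z => by
        have := huniq _ _ (G.smul_mem c (hfg z))
        change f (l • (c • f z) - c • g z) = c • f z at this
        rwa [smul_comm, ← smul_sub, e z] at this }
  refine ⟨J.mkContinuous l⁻¹ fun z => ?_, fun z => ?_, huniq⟩
  · have := hG.norm_le l (hfg z)
    rw [e z] at this
    change ‖f z‖ ≤ _
    rw [inv_mul_eq_div, le_div_iff₀ hl]
    linarith
  · change (f z, l • f z - z) ∈ G
    rw [← hg]
    exact hfg z

/-- The resolvent `(l - G)⁻¹`. -/
def resolvent (hG : IsMaxDissipative G) {l : ℝ} (hl : 0 < l) : X →L[ℝ] X :=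
  (hG.exists_resolvent hl).choose

theorem resolvent_mem (hG : IsMaxDissipative G) {l : ℝ} (hl : 0 < l) (z : X) :
    (hG.resolvent hl z, l • hG.resolvent hl z - z) ∈ G :=
  (hG.exists_resolvent hl).choose_spec.1 z

theorem resolvent_sub (hG : IsMaxDissipative G) {l : ℝ} (hl : 0 < l) {x y : X}
    (h : (x, y) ∈ G) : hG.resolvent hl (l • x - y) = x :=
  (hG.exists_resolvent hl).choose_spec.2 x y h

theorem norm_resolvent_le (hG : IsMaxDissipative G) {l : ℝ} (hl : 0 < l) (z : X) :
    l * ‖hG.resolvent hl z‖ ≤ ‖z‖ := by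
  simpa using hG.norm_le l (hG.resolvent_mem hl z)

/-- With `x` the resolvent at `m` of `z` and `y = m x - z`, the resolvent at `l` sends `l x - y = (l
- m) x + z` back to `x`. -/
theorem resolvent_identity (hG : IsMaxDissipative G) {l m : ℝ} (hl : 0 < l) (hm : 0 < m)
    (z : X) : hG.resolvent hm z
      = (l - m) • hG.resolvent hl (hG.resolvent hm z) + hG.resolvent hl z := by
  have h := hG.resolvent_sub hl (hG.resolvent_mem hm z)
  rw [← sub_add, ← sub_smul, map_add, map_smul] at h
  exact h.symm

theorem commute_resolvent (hG : IsMaxDissipative G) {l m : ℝ} (hl : 0 < l) (hm : 0 < m) :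
    Commute (hG.resolvent hl) (hG.resolvent hm) := by
  rcases eq_or_ne l m with rfl | hne
  · exact Commute.refl _
  ext z
  change hG.resolvent hl (hG.resolvent hm z) = hG.resolvent hm (hG.resolvent hl z)
  have h1 := hG.resolvent_identity hl hm z
  have h2 := hG.resolvent_identity hm hl z
  refine smul_right_injective X (sub_ne_zero.2 hne) ?_
  change (l - m) • _ = (l - m) • _
  rw [← sub_eq_iff_eq_add] at h1 h2
  rw [← h1, ← neg_sub m l, neg_smul, ← h2, neg_sub]

theorem inner_resolvent_le (hG : IsMaxDissipative G) {l : ℝ} (hl : 0 < l) (z : X) :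
    l * ⟪hG.resolvent hl z, z⟫_ℝ ≤ ‖z‖ ^ 2 := by
  have h1 := real_inner_le_norm (hG.resolvent hl z) z
  nlinarith [hG.norm_resolvent_le hl z, norm_nonneg z]

/-- The Yosida approximations of `G`. -/
def yosida (hG : IsMaxDissipative G) (n : ℕ) : X →L[ℝ] X :=
  ((n : ℝ) + 1) ^ 2 • hG.resolvent n.cast_add_one_pos - ((n : ℝ) + 1) • 1

theorem inner_yosida_nonpos (hG : IsMaxDissipative G) (n : ℕ) (x : X) :
    ⟪hG.yosida n x, x⟫_ℝ ≤ 0 := by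
  have h := hG.inner_resolvent_le n.cast_add_one_pos x
  have hn : (0 : ℝ) < n + 1 := n.cast_add_one_pos
  simp only [yosida, _root_.sub_apply, _root_.smul_apply,
    one_apply_eq_self, inner_sub_left, real_inner_smul_left,
    real_inner_self_eq_norm_sq]
  nlinarith

theorem commute_yosida (hG : IsMaxDissipative G) (n m : ℕ) :
    Commute (hG.yosida n) (hG.yosida m) := by
  have h := hG.commute_resolvent n.cast_add_one_pos m.cast_add_one_pos
  refine Commute.sub_left (Commute.sub_right ?_ ?_) (Commute.sub_right ?_ ?_)
  · exact (h.smul_left _).smul_right _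
  · exact ((Commute.one_right _).smul_left _).smul_right _
  · exact ((Commute.one_left _).smul_left _).smul_right _
  · exact ((Commute.one_left _).smul_left _).smul_right _

/-- With `λ = n + 1`, `λ R x - x = R y` on `G`. This form yields both the bound by `‖y‖` and the
convergence to `y`. -/
theorem yosida_apply (hG : IsMaxDissipative G) (n : ℕ) {x y : X} (h : (x, y) ∈ G) :
    hG.yosida n x = ((n : ℝ) + 1) • hG.resolvent n.cast_add_one_pos y := by
  have h1 := hG.resolvent_sub n.cast_add_one_pos h
  rw [map_sub, map_smul, sub_eq_iff_eq_add] at h1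
  simp only [yosida, _root_.sub_apply, _root_.smul_apply,
    one_apply_eq_self]
  rw [sq, mul_smul, h1, smul_add, add_sub_cancel_left]

theorem norm_yosida_le (hG : IsMaxDissipative G) (n : ℕ) {x y : X} (h : (x, y) ∈ G) :
    ‖hG.yosida n x‖ ≤ ‖y‖ := by
  rw [hG.yosida_apply n h, norm_smul, Real.norm_of_nonneg n.cast_add_one_pos.le]
  exact hG.norm_resolvent_le _ y

/-- In a Hilbert space the domain of a maximal dissipative relation is dense. -/
theorem exists_near [CompleteSpace X] (hG : IsMaxDissipative G) (x : X) {ε : ℝ} (hε : 0 < ε) :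
    ∃ z w, (z, w) ∈ G ∧ ‖x - z‖ < ε := by
  have hd : Dense ((G.map (LinearMap.fst ℝ X X) : Submodule ℝ X) : Set X) := by
    rw [Submodule.dense_iff_topologicalClosure_eq_top,
      Submodule.topologicalClosure_eq_top_iff, Submodule.eq_bot_iff]
    intro y hy
    -- A vector `y` orthogonal to the domain is written `u - v` with `(u, v)` in `G`. Orthogonality
    -- to `u` gives `‖u‖² = ⟪v, u⟫ ≤ 0`, so `u = 0`, and single-valuedness then gives `v = 0`.
    obtain ⟨u, v, huv, e⟩ := hG.exists_sub_eq 1 one_pos y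
    have h1 : ⟪u, y⟫_ℝ = 0 := hy u ⟨(u, v), huv, rfl⟩
    rw [← e, one_smul, inner_sub_right, real_inner_self_eq_norm_sq, real_inner_comm] at h1
    have h2 := hG.inner_nonpos u v huv
    have h3 : u = 0 := by
      rw [← norm_eq_zero, ← sq_eq_zero_iff]
      nlinarith [sq_nonneg ‖u‖]
    rw [h3] at huv
    rw [← e, h3, hG.eq_zero v huv, smul_zero, sub_zero]
  obtain ⟨z, ⟨⟨p, w⟩, hp, rfl⟩, hz⟩ := hd.exists_dist_lt x hε
  exact ⟨p, w, hp, by rwa [dist_eq_norm] at hz⟩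

theorem norm_smul_resolvent_sub_le (hG : IsMaxDissipative G) (n : ℕ) {z w : X}
    (h : (z, w) ∈ G) :
    ‖((n : ℝ) + 1) • hG.resolvent n.cast_add_one_pos z - z‖ ≤ ‖w‖ / (n + 1) := by
  have hn : (0 : ℝ) < n + 1 := n.cast_add_one_pos
  have h1 := hG.resolvent_sub hn h
  rw [map_sub, map_smul] at h1
  have h2 : ((n : ℝ) + 1) • hG.resolvent n.cast_add_one_pos z - z = hG.resolvent hn w := by
    nth_rewrite 2 [← h1]
    abel
  rw [h2, le_div_iff₀ hn, mul_comm]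
  exact hG.norm_resolvent_le hn w

/-! ### Convergence of the Yosida approximations and of their exponentials. -/

variable [CompleteSpace X]

/-- On the domain the error is at most `‖w‖/(n+1)`; density and the uniform bound `‖λR‖ ≤ 1` extend
this to every `x`. -/
theorem tendsto_smul_resolvent (hG : IsMaxDissipative G) (x : X) :
    Tendsto (fun n : ℕ => ((n : ℝ) + 1) • hG.resolvent n.cast_add_one_pos x) atTop (𝓝 x) := by
  rw [Metric.tendsto_atTop]
  intro ε hε
  obtain ⟨z, w, hzw, hz⟩ := hG.exists_near x (ε := ε / 3) (by linarith)
  have hlim : Tendsto (fun n : ℕ => ‖w‖ / ((n : ℝ) + 1)) atTop (𝓝 0) :=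
    tendsto_const_nhds.div_atTop
      (tendsto_atTop_add_const_right _ _ tendsto_natCast_atTop_atTop)
  obtain ⟨N, hN⟩ := Metric.tendsto_atTop.1 hlim (ε / 3) (by linarith)
  refine ⟨N, fun n hn => ?_⟩
  have h1 := hG.norm_smul_resolvent_sub_le n hzw
  have h2 := (le_abs_self _).trans_lt (by simpa only [Real.dist_eq, sub_zero] using hN n hn)
  have h3 : ‖((n : ℝ) + 1) • hG.resolvent n.cast_add_one_pos (x - z)‖ ≤ ‖x - z‖ := by
    rw [norm_smul, Real.norm_of_nonneg n.cast_add_one_pos.le]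
    exact hG.norm_resolvent_le _ _
  rw [dist_eq_norm]
  have e : ((n : ℝ) + 1) • hG.resolvent n.cast_add_one_pos x - x
      = ((n : ℝ) + 1) • hG.resolvent n.cast_add_one_pos (x - z)
        + (((n : ℝ) + 1) • hG.resolvent n.cast_add_one_pos z - z) - (x - z) := by
    rw [map_sub, smul_sub]; abel
  rw [e]
  have h4 := norm_sub_le (((n : ℝ) + 1) • hG.resolvent n.cast_add_one_pos (x - z)
    + (((n : ℝ) + 1) • hG.resolvent n.cast_add_one_pos z - z)) (x - z)
  have h5 := norm_add_le (((n : ℝ) + 1) • hG.resolvent n.cast_add_one_pos (x - z))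
    (((n : ℝ) + 1) • hG.resolvent n.cast_add_one_pos z - z)
  linarith

theorem tendsto_yosida (hG : IsMaxDissipative G) {x y : X} (h : (x, y) ∈ G) :
    Tendsto (fun n : ℕ => hG.yosida n x) atTop (𝓝 y) := by
  simp_rw [fun n => hG.yosida_apply n h]
  exact hG.tendsto_smul_resolvent y

/-- For `z` in the domain two exponentials differ by at most `t` times the difference of the Yosida
approximations at `z`, which converge. A general `x` is approximated by such `z`, at the cost of
`2‖x - z‖` since exponentials are contractions. -/
theorem cauchySeq_exp (hG : IsMaxDissipative G) (t : ℝ≥0) (x : X) :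
    CauchySeq fun n : ℕ => NormedSpace.exp ((t : ℝ) • hG.yosida n) x := by
  rw [Metric.cauchySeq_iff]
  intro ε hε
  obtain ⟨z, w, hzw, hz⟩ := hG.exists_near x (ε := ε / 4) (by linarith)
  -- Division is by `t + 1` because `t` may be `0`.
  have ht : (0 : ℝ) < t + 1 := by positivity
  obtain ⟨N, hN⟩ := Metric.cauchySeq_iff.1 (hG.tendsto_yosida hzw).cauchySeq
    (ε / 4 / (t + 1)) (by positivity)
  refine ⟨N, fun m hm n hn => ?_⟩
  have h1 := norm_exp_smul_sub_exp_smul_le (hG.inner_yosida_nonpos m)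
    (hG.inner_yosida_nonpos n) (hG.commute_yosida m n) t.2 z
  have h2 := hN m hm n hn
  rw [dist_eq_norm, lt_div_iff₀ ht] at h2
  have h3 := norm_exp_smul_apply_le (hG.inner_yosida_nonpos m) t.2 (x - z)
  have h4 := norm_exp_smul_apply_le (hG.inner_yosida_nonpos n) t.2 (x - z)
  rw [dist_eq_norm]
  have e : NormedSpace.exp ((t : ℝ) • hG.yosida m) x - NormedSpace.exp ((t : ℝ) • hG.yosida n) x
      = NormedSpace.exp ((t : ℝ) • hG.yosida m) (x - z)
        - NormedSpace.exp ((t : ℝ) • hG.yosida n) (x - z)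
        + (NormedSpace.exp ((t : ℝ) • hG.yosida m) z
          - NormedSpace.exp ((t : ℝ) • hG.yosida n) z) := by
    rw [map_sub, map_sub]; abel
  rw [e]
  refine (norm_add_le _ _).trans_lt ((add_le_add_left (norm_sub_le _ _) _).trans_lt ?_)
  change ‖NormedSpace.exp ((t : ℝ) • hG.yosida m) z
    - NormedSpace.exp ((t : ℝ) • hG.yosida n) z‖ ≤ (t : ℝ) * _ at h1
  change ‖NormedSpace.exp ((t : ℝ) • hG.yosida m) (x - z)‖ ≤ _ at h3
  change ‖NormedSpace.exp ((t : ℝ) • hG.yosida n) (x - z)‖ ≤ _ at h4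
  have h5 : (0 : ℝ) ≤ ‖hG.yosida m z - hG.yosida n z‖ := norm_nonneg _
  nlinarith

/-- `S(t)` is the strong limit of the exponentials. Only the inclusion of `G` in the generator is
obtained here; the converse comes from `mem_of_tendsto`. -/
theorem exists_semigroup (hG : IsMaxDissipative G) :
    ∃ S : ℝ≥0 → X →L[ℝ] X, IsContractionSemigroup S ∧ ∀ x y, (x, y) ∈ G →
      Tendsto (fun t : ℝ≥0 => (t : ℝ)⁻¹ • (S t x - x)) (𝓝[>] 0) (𝓝 y) := by
  set E : ℕ → ℝ≥0 → X →L[ℝ] X := fun n t => NormedSpace.exp ((t : ℝ) • hG.yosida n) with hE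
  have hEle : ∀ n t x, ‖E n t x‖ ≤ ‖x‖ := fun n t x =>
    norm_exp_smul_apply_le (hG.inner_yosida_nonpos n) t.2 x
  choose f hf using fun t x => cauchySeq_tendsto_of_complete (hG.cauchySeq_exp t x)
  replace hf : ∀ t x, Tendsto (fun n => E n t x) atTop (𝓝 (f t x)) := hf
  have hfle : ∀ t x, ‖f t x‖ ≤ ‖x‖ := fun t x =>
    le_of_tendsto (hf t x).norm (Eventually.of_forall fun n => hEle n t x)
  let S : ℝ≥0 → X →L[ℝ] X := fun t =>
    LinearMap.mkContinuous
      { toFun := f t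
        map_add' := fun x y => tendsto_nhds_unique (hf t (x + y)) (by
          simpa only [map_add] using (hf t x).add (hf t y))
        map_smul' := fun c x => tendsto_nhds_unique (hf t (c • x)) (by
          simpa only [map_smul, RingHom.id_apply] using (hf t x).const_smul c) } 1
      fun x => by simpa using hfle t x
  have hS : ∀ t x, Tendsto (fun n => E n t x) atTop (𝓝 (S t x)) := hf
  have hSle : ∀ t x, ‖S t x‖ ≤ ‖x‖ := hfle
  have hSzero : S 0 = ContinuousLinearMap.id ℝ X := by
    ext x
    refine tendsto_nhds_unique (hS 0 x) ?_
    simp [hE, NormedSpace.exp_zero]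
  have hSadd : ∀ s t, S (s + t) = (S s).comp (S t) := by
    intro s t
    ext x
    refine tendsto_nhds_unique (hS (s + t) x) ?_
    -- The argument `E n t x` moves with `n`; its deviation from `S t x` is harmless because every
    -- `E n s` is a contraction.
    have e : ∀ n, E n (s + t) x = E n s (E n t x - S t x) + E n s (S t x) := by
      intro n
      rw [← map_add, sub_add_cancel]
      simp only [hE, NNReal.coe_add, add_smul]
      let _ : NormedAlgebra ℚ (X →L[ℝ] X) := NormedAlgebra.restrictScalars ℚ ℝ _
      rw [NormedSpace.exp_add_of_commute
        (((Commute.refl (hG.yosida n)).smul_left _).smul_right _)]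
      rfl
    simp_rw [e]
    have h0 : Tendsto (fun n => E n s (E n t x - S t x)) atTop (𝓝 0) := by
      refine squeeze_zero_norm (fun n => hEle n s _) ?_
      simpa using ((hS t x).sub_const (S t x)).norm
    simpa using h0.add (hS s (S t x))
  have hSub : ∀ t x y, (x, y) ∈ G → ‖S t x - x‖ ≤ t * ‖y‖ := by
    intro t x y h
    refine le_of_tendsto ((hS t x).sub_const x).norm (Eventually.of_forall fun n => ?_)
    exact (norm_exp_smul_sub_self_le (hG.inner_yosida_nonpos n) t.2 x).trans
      (mul_le_mul_of_nonneg_left (hG.norm_yosida_le n h) t.2)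
  have hSuba : ∀ x z w (t : ℝ≥0), (z, w) ∈ G → ‖S t x - x‖ ≤ 2 * ‖x - z‖ + t * ‖w‖ := by
    intro x z w t h
    have e : S t x - x = S t (x - z) + (S t z - z) - (x - z) := by rw [map_sub]; abel
    rw [e]
    have h1 := norm_sub_le (S t (x - z) + (S t z - z)) (x - z)
    have h2 := norm_add_le (S t (x - z)) (S t z - z)
    linarith [hSle t (x - z), hSub t z w h]
  -- A modulus of continuity at time `0` that is independent of `n`; it serves as the constant of
  -- the remainder estimate.
  have hEuba : ∀ n y z w (t : ℝ≥0), (z, w) ∈ G → ‖E n t y - y‖ ≤ 2 * ‖y - z‖ + t * ‖w‖ := by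
    intro n x z w t h
    have e : E n t x - x = E n t (x - z) + (E n t z - z) - (x - z) := by rw [map_sub]; abel
    rw [e]
    have h1 := norm_sub_le (E n t (x - z) + (E n t z - z)) (x - z)
    have h2 := norm_add_le (E n t (x - z)) (E n t z - z)
    have h3 : ‖E n t z - z‖ ≤ t * ‖w‖ :=
      (norm_exp_smul_sub_self_le (hG.inner_yosida_nonpos n) t.2 z).trans
        (mul_le_mul_of_nonneg_left (hG.norm_yosida_le n h) t.2)
    linarith [hEle n t (x - z)]
  have hcont0 : ∀ x ε, 0 < ε → ∃ δ > 0, ∀ t : ℝ≥0, (t : ℝ) < δ → ‖S t x - x‖ < ε := by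
    intro x ε hε
    obtain ⟨z, w, hzw, hz⟩ := hG.exists_near x (ε := ε / 4) (by linarith)
    refine ⟨ε / 2 / (‖w‖ + 1), by positivity, fun t ht => ?_⟩
    rw [lt_div_iff₀ (by positivity)] at ht
    have := hSuba x z w t hzw
    have h0 : (0 : ℝ) ≤ t := t.2
    nlinarith
  refine ⟨S, ⟨hSzero, hSadd, hSle, fun x => ?_⟩, fun x y h => ?_⟩
  · rw [Metric.continuous_iff]
    intro t ε hε
    obtain ⟨δ, hδ, H⟩ := hcont0 x ε hε
    refine ⟨δ, hδ, fun s hs => ?_⟩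
    rw [NNReal.dist_eq] at hs
    -- For `q = p + r`, `S(p)x - S(q)x = S(p)(x - S(r)x)`, so continuity everywhere reduces to
    -- continuity at `0`.
    have key : ∀ p q : ℝ≥0, p ≤ q → |(p : ℝ) - q| < δ → dist (S p x) (S q x) < ε := by
      intro p q hpq hd
      obtain ⟨r, rfl⟩ := exists_add_of_le hpq
      rw [dist_comm, dist_eq_norm, hSadd, ContinuousLinearMap.comp_apply, ← map_sub]
      refine (hSle _ _).trans_lt (H r ?_)
      simpa using hd
    rcases le_total s t with hst | hst
    · exact key s t hst hs
    · rw [dist_comm]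
      exact key t s hst (by rwa [abs_sub_comm])
  · rw [Metric.tendsto_nhdsWithin_nhds]
    intro ε hε
    obtain ⟨z, w, hzw, hz⟩ := hG.exists_near y (ε := ε / 4) (by linarith)
    refine ⟨ε / 2 / (‖w‖ + 1), by positivity, fun {t} ht0 ht => ?_⟩
    have ht0' : (0 : ℝ) < t := NNReal.coe_pos.2 ht0
    rw [NNReal.dist_eq, NNReal.coe_zero, sub_zero, abs_of_pos ht0',
      lt_div_iff₀ (by positivity)] at ht
    -- The remainder estimate for the Yosida approximations, in the limit; the `0` is the limit of
    -- `‖hG.yosida n x - y‖`.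
    have h1 : ‖S t x - x - (t : ℝ) • y‖ ≤ t * (0 + (2 * ‖y - z‖ + t * ‖w‖)) := by
      have hlim1 := ((hS t x).sub_const x).sub_const ((t : ℝ) • y) |>.norm
      have hlim2 : Tendsto (fun n => (t : ℝ) * (‖hG.yosida n x - y‖ + (2 * ‖y - z‖ + t * ‖w‖)))
          atTop (𝓝 (t * (0 + (2 * ‖y - z‖ + t * ‖w‖)))) := by
        refine (Tendsto.add_const _ ?_).const_mul _
        simpa using ((hG.tendsto_yosida h).sub_const y).norm
      refine le_of_tendsto_of_tendsto' hlim1 hlim2 fun n => ?_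
      refine norm_exp_smul_sub_self_sub_le (hG.inner_yosida_nonpos n) t.2 x y fun s hs => ?_
      refine (hEuba n y z w ⟨s, hs.1⟩ hzw).trans ?_
      gcongr
      exact hs.2
    have e : (t : ℝ)⁻¹ • (S t x - x) - y = (t : ℝ)⁻¹ • (S t x - x - (t : ℝ) • y) := by
      rw [smul_sub _ _ ((t : ℝ) • y), inv_smul_smul₀ ht0'.ne']
    rw [dist_eq_norm, e, norm_smul, norm_inv, Real.norm_of_nonneg ht0'.le, inv_mul_eq_div,
      div_lt_iff₀ ht0']
    refine h1.trans_lt ?_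
    rw [mul_comm]
    gcongr
    nlinarith

end IsMaxDissipative

/-! ### The generator of a contraction semigroup -/

namespace IsContractionSemigroup

variable {S : ℝ≥0 → X →L[ℝ] X}

/-- A linear relation contained in the generator of a contraction semigroup contains the generator
if `l - G` is onto for some `l > 0`. -/
theorem mem_of_tendsto (hS : IsContractionSemigroup S) {G : Submodule ℝ (X × X)}
    (hG : ∀ x y, (x, y) ∈ G →
      Tendsto (fun t : ℝ≥0 => (t : ℝ)⁻¹ • (S t x - x)) (𝓝[>] 0) (𝓝 y))
    {l : ℝ} (hl : 0 < l) (hsurj : ∀ z, ∃ x y, (x, y) ∈ G ∧ l • x - y = z) {x y : X}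
    (h : Tendsto (fun t : ℝ≥0 => (t : ℝ)⁻¹ • (S t x - x)) (𝓝[>] 0) (𝓝 y)) : (x, y) ∈ G := by
  -- Solving for the same right-hand side inside `G`, the difference `x - z` is an eigenvector of
  -- the generator for `l > 0`, or zero. The generator is dissipative, so it is zero.
  obtain ⟨z, w, hzw, e⟩ := hsurj (l • x - y)
  have e' : y - w = l • (x - z) := by
    have hw : w = l • z - (l • x - y) := by rw [← e, sub_sub_cancel]
    rw [hw, smul_sub]
    abel
  have h1 : Tendsto (fun t : ℝ≥0 => (t : ℝ)⁻¹ • (S t (x - z) - (x - z))) (𝓝[>] 0)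
      (𝓝 (l • (x - z))) := by
    rw [← e']
    refine (h.sub (hG z w hzw)).congr fun t => ?_
    rw [← smul_sub, map_sub]
    congr 1
    abel
  have h2 : ⟪l • (x - z), x - z⟫_ℝ ≤ 0 := by
    refine le_of_tendsto (h1.inner tendsto_const_nhds) (Eventually.of_forall fun t => ?_)
    rw [real_inner_smul_left, inner_sub_left, real_inner_self_eq_norm_sq]
    have h3 := real_inner_le_norm (S t (x - z)) (x - z)
    have h4 := hS.contraction t (x - z)
    refine mul_nonpos_of_nonneg_of_nonpos (inv_nonneg.2 t.2) ?_
    nlinarith [norm_nonneg (x - z)]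
  rw [real_inner_smul_left, real_inner_self_eq_norm_sq] at h2
  have h5 : x - z = 0 := by
    rw [← norm_eq_zero, ← sq_eq_zero_iff]
    nlinarith [sq_nonneg ‖x - z‖]
  rw [h5, smul_zero, sub_eq_zero] at e'
  rw [sub_eq_zero.1 h5, e']
  exact hzw

/-- For `s > t`, `S(s)x - S(t)x = S(t)(S(s-t)x - x)`. The right derivative is all that the later
monotonicity argument needs. -/
theorem hasDerivWithinAt (hS : IsContractionSemigroup S) {x y : X}
    (h : Tendsto (fun t : ℝ≥0 => (t : ℝ)⁻¹ • (S t x - x)) (𝓝[>] 0) (𝓝 y)) {t : ℝ}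
    (ht : 0 ≤ t) :
    HasDerivWithinAt (fun s : ℝ => S s.toNNReal x) (S t.toNNReal y) (Ici t) t := by
  rw [← hasDerivWithinAt_Ioi_iff_Ici, hasDerivWithinAt_iff_tendsto_slope' self_notMem_Ioi]
  have h1 : Tendsto (fun s : ℝ => (s - t).toNNReal) (𝓝[>] t) (𝓝[>] 0) := by
    refine tendsto_nhdsWithin_iff.2 ⟨?_, ?_⟩
    · have : Tendsto (fun s : ℝ => (s - t).toNNReal) (𝓝 t) (𝓝 (t - t).toNNReal) :=
        (continuous_real_toNNReal.comp (continuous_id.sub continuous_const)).tendsto t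
      rw [sub_self, Real.toNNReal_zero] at this
      exact this.mono_left nhdsWithin_le_nhds
    · filter_upwards [self_mem_nhdsWithin] with s hs
      exact Real.toNNReal_pos.2 (sub_pos.2 hs)
  refine (((S t.toNNReal).continuous.tendsto y).comp (h.comp h1)).congr' ?_
  filter_upwards [self_mem_nhdsWithin] with s hs
  have hst : 0 ≤ s - t := (sub_pos.2 hs).le
  simp only [Function.comp_apply, slope, vsub_eq_sub, Real.coe_toNNReal _ hst]
  have e : s.toNNReal = t.toNNReal + (s - t).toNNReal := by
    rw [← Real.toNNReal_add ht hst, add_sub_cancel]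
  rw [map_smul, map_sub, e, hS.add]
  rfl

/-- The generator commutes with the semigroup. -/
theorem tendsto_apply (hS : IsContractionSemigroup S) {x y : X}
    (h : Tendsto (fun t : ℝ≥0 => (t : ℝ)⁻¹ • (S t x - x)) (𝓝[>] 0) (𝓝 y)) (s : ℝ≥0) :
    Tendsto (fun t : ℝ≥0 => (t : ℝ)⁻¹ • (S t (S s x) - S s x)) (𝓝[>] 0) (𝓝 (S s y)) := by
  refine (((S s).continuous.tendsto y).comp h).congr fun t => ?_
  have e : S t (S s x) = S s (S t x) := by
    rw [← ContinuousLinearMap.comp_apply, ← ContinuousLinearMap.comp_apply, ← hS.add, ← hS.add,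
      add_comm]
  rw [Function.comp_apply, map_smul, map_sub, e]

end IsContractionSemigroup

end Semigroup

/-- A dissipative operator `T` on a possibly incomplete inner product space `H` generates a
contraction semigroup as soon as `H` carries a finer Hilbert space structure `X` in which `T` is
quasi-dissipative and `l - T` is onto for all large `l`. -/
theorem exists_generator_of_finer_hilbert {H X : Type*} [NormedAddCommGroup H]
    [InnerProductSpace ℝ H] [NormedAddCommGroup X] [InnerProductSpace ℝ X] [CompleteSpace X]
    (T : H →ₗ.[ℝ] H) (hT : IsDissipative T) (e : X ≃ₗ[ℝ] H) (he : Continuous e) {c : ℝ}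
    (hc : 0 ≤ c) (hdiss : ∀ x y : X, (e x, e y) ∈ T.graph → ⟪y, x⟫_ℝ ≤ c * ‖x‖ ^ 2)
    (hsurj : ∀ l : ℝ, c < l → ∀ z : H, ∃ x y, (x, y) ∈ T.graph ∧ l • x - y = z) :
    Dense (T.domain : Set H) ∧
      ∃ S : ℝ≥0 → H →L[ℝ] H, IsContractionSemigroup S ∧ IsGenerator T S := by
  -- The graph of `T - c`, transported to `X`.
  let G : Submodule ℝ (X × X) := T.graph.comap
    (LinearMap.prod (e.toLinearMap ∘ₗ LinearMap.fst ℝ X X)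
      (e.toLinearMap ∘ₗ (LinearMap.snd ℝ X X + c • LinearMap.fst ℝ X X)))
  have hGmem : ∀ x y, (x, y) ∈ G ↔ (e x, e (y + c • x)) ∈ T.graph := fun x y => Iff.rfl
  have hG : IsMaxDissipative G := by
    refine ⟨fun x y h => ?_, fun y h => ?_, fun l hl z => ?_⟩
    · have := hdiss x (y + c • x) h
      rw [inner_add_left, real_inner_smul_left, real_inner_self_eq_norm_sq] at this
      linarith
    · rw [hGmem, smul_zero, add_zero, map_zero] at h
      exact (map_eq_zero_iff e e.injective).1 (T.graph_fst_eq_zero_snd h rfl)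
    · obtain ⟨x, y, hxy, h⟩ := hsurj (l + c) (by linarith) (e z)
      refine ⟨e.symm x, e.symm y - c • e.symm x, ?_, ?_⟩
      · rw [hGmem, sub_add_cancel, e.apply_symm_apply, e.apply_symm_apply]
        exact hxy
      · apply e.injective
        rw [← h]
        simp only [map_sub, map_smul, e.apply_symm_apply, add_smul]
        abel
  have hdom : Dense {x : X | ∃ y, (x, y) ∈ G} := by
    rw [Metric.dense_iff]
    intro x r hr
    obtain ⟨z, w, hzw, hz⟩ := hG.exists_near x hr
    exact ⟨z, by rwa [mem_ball_iff_norm'], w, hzw⟩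
  obtain ⟨S, hS, hSG⟩ := hG.exists_semigroup
  -- The generator commutes with `S(t)` and, by maximality, coincides with `G`; orbits therefore
  -- stay in the domain.
  have hmem : ∀ x y, (x, y) ∈ G → ∀ t, (S t x, S t y) ∈ G := fun x y h t =>
    hS.mem_of_tendsto hSG one_pos (hG.exists_sub_eq 1 one_pos) (hS.tendsto_apply (hSG x y h) t)
  let E : X →L[ℝ] H := ⟨e.toLinearMap, he⟩
  -- The factor `exp(cs)` undoes the shift by `c`: the curve solves `ẏ = T y` in `H`.
  have hderiv : ∀ x y, (x, y) ∈ G → ∀ t : ℝ, 0 ≤ t →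
      HasDerivWithinAt (fun s : ℝ => Real.exp (c * s) • E (S s.toNNReal x))
        (Real.exp (c * t) • E (S t.toNNReal y + c • S t.toNNReal x)) (Ici t) t := by
    intro x y h t ht
    have h1 := E.hasFDerivAt.comp_hasDerivWithinAt t (hS.hasDerivWithinAt (hSG x y h) ht)
    have h2 : HasDerivWithinAt (fun s : ℝ => Real.exp (c * s)) (Real.exp (c * t) * c) (Ici t) t :=
      ((hasDerivAt_const_mul c).exp).hasDerivWithinAt
    refine (h2.smul h1).congr_deriv ?_
    simp only [Function.comp_apply, map_add, map_smul, smul_add, mul_smul]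
  have hcontr : ∀ (t : ℝ≥0) (x : X), ‖Real.exp (c * t) • E (S t x)‖ ≤ ‖E x‖ := by
    intro t
    have hcl : IsClosed {x : X | ‖Real.exp (c * t) • E (S t x)‖ ≤ ‖E x‖} := by
      refine isClosed_le ?_ ?_
      · exact ((E.continuous.comp (S t).continuous).const_smul _).norm
      · exact E.continuous.norm
    have hsub : {x : X | ∃ y, (x, y) ∈ G} ⊆ {x : X | ‖Real.exp (c * t) • E (S t x)‖ ≤ ‖E x‖} := by
      rintro x ⟨y, h⟩
      have hcont : Continuous fun s : ℝ => Real.exp (c * s) • E (S s.toNNReal x) :=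
        (Real.continuous_exp.comp (continuous_const.mul continuous_id)).smul
          (E.continuous.comp ((hS.continuous x).comp continuous_real_toNNReal))
      -- The squared norm of `H` along the orbit has right derivative `2 exp(2cs)⟪Tp, p⟫ ≤ 0` with
      -- `p = e (S s x)`, by dissipativity of `T` for the coarse inner product.
      have key := image_le_of_deriv_right_le_deriv_boundary (a := 0) (b := t)
        (f := fun s : ℝ => ‖Real.exp (c * s) • E (S s.toNNReal x)‖ ^ 2)
        (f' := fun s => 2 * ⟪Real.exp (c * s) • E (S s.toNNReal x),
          Real.exp (c * s) • E (S s.toNNReal y + c • S s.toNNReal x)⟫_ℝ)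
        (B := fun _ => ‖E x‖ ^ 2) (B' := fun _ => 0) (hcont.norm.pow 2).continuousOn
        (fun s hs => (hderiv x y h s hs.1).norm_sq)
        (by simp [hS.zero]) continuousOn_const (fun s _ => hasDerivWithinAt_const _ _ _)
        (fun s _ => by
          obtain ⟨p, hp1, hp2⟩ := (LinearPMap.mem_graph_iff T).1
            ((hGmem _ _).1 (hmem x y h s.toNNReal))
          have h3 := hT p
          rw [hp1, hp2, real_inner_comm] at h3
          dsimp only at h3
          rw [real_inner_smul_left, real_inner_smul_right]
          change 2 * (_ * (_ * ⟪e _, e _⟫_ℝ)) ≤ 0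
          have h4 : 0 ≤ Real.exp (c * s) * Real.exp (c * s) := by positivity
          have h5 := mul_nonpos_of_nonneg_of_nonpos h4 h3
          linarith)
        (right_mem_Icc.2 t.2)
      simp only [Real.toNNReal_coe] at key
      exact le_of_sq_le_sq key (norm_nonneg _)
    exact fun x => (hcl.closure_subset_iff.2 hsub) (hdom x)
  let U : ℝ≥0 → H →L[ℝ] H := fun t =>
    LinearMap.mkContinuous (Real.exp (c * t) •
      (e.toLinearMap ∘ₗ (S t).toLinearMap ∘ₗ e.symm.toLinearMap)) 1 fun x => by
        have := hcontr t (e.symm x)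
        rw [one_mul]
        refine this.trans_eq ?_
        change ‖e (e.symm x)‖ = _
        rw [e.apply_symm_apply]
  have hU : ∀ t x, U t (e x) = Real.exp (c * t) • E (S t x) := by
    intro t x
    change Real.exp (c * t) • e (S t (e.symm (e x))) = _
    rw [e.symm_apply_apply]
    rfl
  have hUS : IsContractionSemigroup U := by
    refine ⟨?_, fun s t => ?_, fun t x => ?_, fun x => ?_⟩
    · ext x
      obtain ⟨x, rfl⟩ := e.surjective x
      rw [hU, hS.zero]
      simp [E]
    · ext x
      obtain ⟨x, rfl⟩ := e.surjective x
      rw [ContinuousLinearMap.comp_apply, hU, hU, map_smul]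
      change _ = _ • U s (e (S t x))
      rw [hU, hS.add, smul_smul, ← Real.exp_add, NNReal.coe_add]
      congr 2
      ring
    · obtain ⟨x, rfl⟩ := e.surjective x
      rw [hU]
      exact hcontr t x
    · obtain ⟨x, rfl⟩ := e.surjective x
      simp_rw [hU]
      exact (Real.continuous_exp.comp (continuous_const.mul NNReal.continuous_coe)).smul
        (E.continuous.comp (hS.continuous x))
  have hgen : ∀ x y, (x, y) ∈ T.graph →
      Tendsto (fun t : ℝ≥0 => (t : ℝ)⁻¹ • (U t x - x)) (𝓝[>] 0) (𝓝 y) := by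
    intro x y h
    obtain ⟨x, rfl⟩ := e.surjective x
    obtain ⟨y, rfl⟩ := e.surjective y
    have hxy : (x, y - c • x) ∈ G := by
      rw [hGmem, sub_add_cancel]
      exact h
    have h1 := hderiv x _ hxy 0 le_rfl
    rw [← hasDerivWithinAt_Ioi_iff_Ici, hasDerivWithinAt_iff_tendsto_slope' self_notMem_Ioi] at h1
    have h2 : Tendsto (fun t : ℝ≥0 => (t : ℝ)) (𝓝[>] 0) (𝓝[>] 0) := by
      refine tendsto_nhdsWithin_iff.2
        ⟨(NNReal.continuous_coe.tendsto 0).mono_left nhdsWithin_le_nhds, ?_⟩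
      filter_upwards [self_mem_nhdsWithin] with s hs
      exact NNReal.coe_pos.2 hs
    have h3 := h1.comp h2
    simp only [Real.toNNReal_zero, hS.zero, mul_zero, Real.exp_zero, one_smul,
      ContinuousLinearMap.id_apply, sub_add_cancel] at h3
    refine h3.congr fun t => ?_
    simp [slope, hU, hS.zero, E]
  refine ⟨?_, U, hUS, fun x y => ⟨hgen x y, fun h =>
    hUS.mem_of_tendsto hgen (l := c + 1) (by linarith) (hsurj _ (by linarith)) h⟩⟩
  have hd := e.surjective.denseRange.dense_image he hdom
  refine hd.mono ?_
  rintro _ ⟨x, ⟨y, h⟩, rfl⟩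
  exact LinearPMap.mem_domain_of_mem_graph h

/-! ### Indefinite integrals -/

/-- `F` is an indefinite integral of `f` on the interval between `x` and `y`. -/
def IsPrimitive (F f : ℝ → ℝ) (x y : ℝ) : Prop :=
  IntervalIntegrable f volume x y ∧ ∀ t ∈ uIcc x y, F t = F x + ∫ s in x..t, f s

namespace IsPrimitive

variable {F f G g : ℝ → ℝ} {x y : ℝ}

theorem intervalIntegrable_of_mem (h : IsPrimitive F f x y) {s t : ℝ} (hs : s ∈ uIcc x y)
    (ht : t ∈ uIcc x y) : IntervalIntegrable f volume s t :=
  h.1.mono_set (uIcc_subset_uIcc hs ht)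

theorem mono (h : IsPrimitive F f x y) {s t : ℝ} (hs : s ∈ uIcc x y) (ht : t ∈ uIcc x y) :
    IsPrimitive F f s t := by
  refine ⟨h.intervalIntegrable_of_mem hs ht, fun r hr => ?_⟩
  have hr' := uIcc_subset_uIcc hs ht hr
  rw [h.2 r hr', h.2 s hs, add_assoc, intervalIntegral.integral_add_adjacent_intervals
    (h.intervalIntegrable_of_mem left_mem_uIcc hs) (h.intervalIntegrable_of_mem hs hr')]

theorem congr (h : IsPrimitive F f x y) (hF : EqOn F G (uIcc x y))
    (hf : ∀ᵐ t, t ∈ uIoc x y → f t = g t) : IsPrimitive G g x y := by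
  refine ⟨h.1.congr_ae ((ae_restrict_iff' measurableSet_uIoc).2 hf), fun t ht => ?_⟩
  rw [← hF ht, ← hF left_mem_uIcc, h.2 t ht]
  congr 1
  refine intervalIntegral.integral_congr_ae ?_
  filter_upwards [hf] with s hs hs'
  exact hs (uIoc_subset_uIoc_of_uIcc_subset_uIcc (uIcc_subset_uIcc left_mem_uIcc ht) hs')

/-- The integral formula replaces `F`, which is arbitrary outside the interval and so may fail to be
differentiable at its endpoints. -/
theorem absolutelyContinuous (h : IsPrimitive F f x y) :
    AbsolutelyContinuousOnInterval (fun t => F x + ∫ s in x..t, f s) x y := by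
  refine AbsolutelyContinuousOnInterval.add ?_
    (h.1.absolutelyContinuousOnInterval_intervalIntegral left_mem_uIcc)
  exact contDiffOn_const.absolutelyContinuousOnInterval

theorem ae_hasDerivAt (h : IsPrimitive F f x y) :
    ∀ᵐ t, t ∈ uIcc x y → HasDerivAt (fun t => F x + ∫ s in x..t, f s) (f t) t := by
  filter_upwards [h.1.ae_hasDerivAt_integral] with t ht hxy
  exact (ht hxy x left_mem_uIcc).const_add _

theorem continuousOn (h : IsPrimitive F f x y) : ContinuousOn F (uIcc x y) :=
  h.absolutelyContinuous.continuousOn.congr h.2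

theorem integral_mul_add_mul (hF : IsPrimitive F f x y) (hG : IsPrimitive G g x y) :
    ∫ s in x..y, (f s * G s + F s * g s) = F y * G y - F x * G x := by
  have h := hF.absolutelyContinuous.integral_deriv_mul_eq_sub hG.absolutelyContinuous
  simp only [intervalIntegral.integral_same, add_zero] at h
  rw [← hF.2 y right_mem_uIcc, ← hG.2 y right_mem_uIcc] at h
  rw [← h]
  refine intervalIntegral.integral_congr_ae ?_
  filter_upwards [hF.ae_hasDerivAt, hG.ae_hasDerivAt] with s h1 h2 hs
  have hs' := uIoc_subset_uIcc hs
  rw [(h1 hs').deriv, (h2 hs').deriv, hF.2 s hs', hG.2 s hs']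

theorem mul (hF : IsPrimitive F f x y) (hG : IsPrimitive G g x y) :
    IsPrimitive (fun t => F t * G t) (fun t => f t * G t + F t * g t) x y := by
  refine ⟨(hF.1.mul_continuousOn hG.continuousOn).add (hG.1.continuousOn_mul hF.continuousOn),
    fun t ht => ?_⟩
  rw [(hF.mono left_mem_uIcc ht).integral_mul_add_mul (hG.mono left_mem_uIcc ht)]
  ring

theorem of_integral (c : ℝ) {z : ℝ} (hf : IntervalIntegrable f volume x y)
    (hz : IntervalIntegrable f volume z x) :
    IsPrimitive (fun t => c + ∫ s in z..t, f s) f x y := by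
  refine ⟨hf, fun t ht => ?_⟩
  rw [add_assoc, intervalIntegral.integral_add_adjacent_intervals hz
    (hf.mono_set (uIcc_subset_uIcc left_mem_uIcc ht))]

theorem of_hasDerivAt (h : ∀ t ∈ uIcc x y, HasDerivAt F (f t) t)
    (hf : ContinuousOn f (uIcc x y)) : IsPrimitive F f x y := by
  refine ⟨hf.intervalIntegrable, fun t ht => ?_⟩
  have hsub := uIcc_subset_uIcc left_mem_uIcc ht
  rw [intervalIntegral.integral_eq_sub_of_hasDerivAt (fun s hs => h s (hsub hs))
    (hf.mono hsub).intervalIntegrable]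
  ring

end IsPrimitive

/-! ### Weak derivatives and indefinite integrals -/

theorem uIcc_subset_Ioo {x y : ℝ} (hx : x ∈ Ioo (0 : ℝ) 1) (hy : y ∈ Ioo (0 : ℝ) 1) :
    uIcc x y ⊆ Ioo 0 1 := ordConnected_Ioo.uIcc_subset hx hy

theorem LocallyIntegrableOn.intervalIntegrable {f : ℝ → ℝ}
    (hf : LocallyIntegrableOn f (Ioo 0 1)) {x y : ℝ} (hx : x ∈ Ioo (0 : ℝ) 1)
    (hy : y ∈ Ioo (0 : ℝ) 1) : IntervalIntegrable f volume x y := by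
  rw [intervalIntegrable_iff]
  exact ((hf.mono_set (uIcc_subset_Ioo hx hy)).integrableOn_isCompact isCompact_uIcc).mono_set
    uIoc_subset_uIcc

theorem locallyIntegrableOn_of_intervalIntegrable {f : ℝ → ℝ}
    (hf : ∀ x ∈ Ioo (0 : ℝ) 1, ∀ y ∈ Ioo (0 : ℝ) 1, IntervalIntegrable f volume x y) :
    LocallyIntegrableOn f (Ioo 0 1) := by
  intro x hx
  have h := hf (x / 2) ⟨by linarith [hx.1], by linarith [hx.2]⟩ ((x + 1) / 2)
    ⟨by linarith [hx.1], by linarith [hx.2]⟩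
  rw [intervalIntegrable_iff_integrableOn_Icc_of_le (by linarith [hx.1])] at h
  exact ⟨_, mem_nhdsWithin_of_mem_nhds
    (Icc_mem_nhds (by linarith [hx.1]) (by linarith [hx.2])), h⟩

theorem IsTest.exists_support_subset {φ : ℝ → ℝ} (h : IsTest φ) :
    ∃ m ∈ Ioo (0 : ℝ) 1, ∃ M ∈ Ioo (0 : ℝ) 1, m ≤ M ∧ tsupport φ ⊆ Ioo m M := by
  -- The point `1/2` keeps the compact set nonempty when `φ = 0`, so that its extrema exist.
  have hK : IsCompact (tsupport φ ∪ {1 / 2}) := h.2.1.isCompact.union isCompact_singleton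
  have hKne : (tsupport φ ∪ {1 / 2}).Nonempty := ⟨1 / 2, Or.inr rfl⟩
  have hKs : tsupport φ ∪ {1 / 2} ⊆ Ioo (0 : ℝ) 1 := by
    refine union_subset h.2.2 ?_
    rw [singleton_subset_iff]; constructor <;> norm_num
  obtain ⟨m, hm⟩ := hK.exists_isLeast hKne
  obtain ⟨M, hM⟩ := hK.exists_isGreatest hKne
  have hm' := hKs hm.1
  have hM' := hKs hM.1
  have hle := hm.2 hM.1
  refine ⟨m / 2, ⟨by linarith [hm'.1], by linarith [hm'.2]⟩, (M + 1) / 2,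
    ⟨by linarith [hM'.1], by linarith [hM'.2]⟩, by linarith [hM'.2, hm'.1], fun x hx => ?_⟩
  have h1 := hm.2 (Or.inl hx)
  have h2 := hM.2 (Or.inl hx)
  exact ⟨by linarith [hm'.1], by linarith [hM'.2]⟩

theorem setIntegral_eq_intervalIntegral_of_support {f : ℝ → ℝ} {m M : ℝ}
    (hm : m ∈ Ioo (0 : ℝ) 1) (hM : M ∈ Ioo (0 : ℝ) 1) (hmM : m ≤ M)
    (hf : ∀ x, x ∉ Ioo m M → f x = 0) : ∫ x in Ioo (0 : ℝ) 1, f x = ∫ x in m..M, f x := by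
  rw [intervalIntegral.integral_of_le hmM, integral_Ioc_eq_integral_Ioo]
  exact setIntegral_eq_of_subset_of_forall_sdiff_eq_zero measurableSet_Ioo
    (Ioo_subset_Ioo hm.1.le hM.2.le) fun x hx => hf x hx.2

/-- Integration by parts on an interval `[m, M]` containing the support of the test function, which
vanishes at both ends. -/
theorem HasWeakDeriv.of_isPrimitive {F f : ℝ → ℝ}
    (h : ∀ x ∈ Ioo (0 : ℝ) 1, ∀ y ∈ Ioo (0 : ℝ) 1, IsPrimitive F f x y) : HasWeakDeriv F f := by
  refine ⟨locallyIntegrableOn_of_intervalIntegrable fun x hx y hy =>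
    (h x hx y hy).continuousOn.intervalIntegrable,
    locallyIntegrableOn_of_intervalIntegrable fun x hx y hy => (h x hx y hy).1, fun φ hφ => ?_⟩
  obtain ⟨m, hm, M, hM, hmM, hs⟩ := hφ.exists_support_subset
  have hφ0 : ∀ x, x ∉ Ioo m M → φ x = 0 := fun x hx =>
    image_eq_zero_of_notMem_tsupport fun h' => hx (hs h')
  have hφ1 : ∀ x, x ∉ Ioo m M → _root_.deriv φ x = 0 := fun x hx =>
    image_eq_zero_of_notMem_tsupport fun h' => hx (hs (tsupport_deriv_subset h'))
  have hcφ : Continuous (_root_.deriv φ) := hφ.deriv.1.continuous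
  have hpφ : IsPrimitive φ (_root_.deriv φ) m M := IsPrimitive.of_hasDerivAt
    (fun t _ => (hφ.1.differentiable (by simp) t).hasDerivAt) hcφ.continuousOn
  have hF := h m hm M hM
  rw [setIntegral_eq_intervalIntegral_of_support hm hM hmM fun x hx => by rw [hφ1 x hx, mul_zero],
    setIntegral_eq_intervalIntegral_of_support hm hM hmM fun x hx => by rw [hφ0 x hx, mul_zero],
    eq_neg_iff_add_eq_zero, add_comm, ← intervalIntegral.integral_add
      (hF.1.mul_continuousOn hpφ.continuousOn) (hpφ.1.continuousOn_mul hF.continuousOn),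
    hF.integral_mul_add_mul hpφ, hφ0 m (by simp), hφ0 M (by simp)]
  ring

theorem isPrimitive_integral {f : ℝ → ℝ} (hf : LocallyIntegrableOn f (Ioo 0 1)) (c : ℝ) :
    ∀ x ∈ Ioo (0 : ℝ) 1, ∀ y ∈ Ioo (0 : ℝ) 1,
      IsPrimitive (fun t => c + ∫ s in (1 / 2 : ℝ)..t, f s) f x y := fun _ hx _ hy =>
  IsPrimitive.of_integral c (LocallyIntegrableOn.intervalIntegrable hf hx hy)
    (LocallyIntegrableOn.intervalIntegrable hf (by constructor <;> norm_num) hx)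

theorem HasWeakDeriv.exists_ae_eq {F G f : ℝ → ℝ} (h : HasWeakDeriv F f)
    (hG : HasWeakDeriv G f) : ∃ c : ℝ, F =ᵐ[leb] fun t => c + G t := by
  have h1 := (h.add (hG.smul (-1))).congr (EventuallyEq.refl _ _)
    (g' := 0) (Eventually.of_forall fun x => by simp)
  obtain ⟨c, hc⟩ := h1.ae_const
  refine ⟨c, ?_⟩
  filter_upwards [hc] with x hx
  simp only [Pi.add_apply, Pi.smul_apply, smul_eq_mul] at hx
  linarith

theorem HasWeakDeriv.exists_primitive {F f : ℝ → ℝ} (h : HasWeakDeriv F f) :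
    ∃ c : ℝ, F =ᵐ[leb] fun t => c + ∫ s in (1 / 2 : ℝ)..t, f s := by
  obtain ⟨c, hc⟩ := h.exists_ae_eq (HasWeakDeriv.of_isPrimitive (isPrimitive_integral h.2.1 0))
  exact ⟨c, by simpa using hc⟩

/-- Product rule for a weak derivative and a continuously differentiable factor. -/
theorem HasWeakDeriv.mul_of_hasDerivAt {F f w w' : ℝ → ℝ} (h : HasWeakDeriv F f)
    (hw : ∀ x ∈ Ioo (0 : ℝ) 1, HasDerivAt w (w' x) x) (hw' : ContinuousOn w' (Ioo 0 1)) :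
    HasWeakDeriv (fun x => w x * F x) (fun x => w' x * F x + w x * f x) := by
  obtain ⟨c, hc⟩ := h.exists_primitive
  have h1 := HasWeakDeriv.of_isPrimitive fun x hx y hy =>
    (IsPrimitive.of_hasDerivAt (fun t ht => hw t (uIcc_subset_Ioo hx hy ht))
      (hw'.mono (uIcc_subset_Ioo hx hy))).mul (isPrimitive_integral h.2.1 c x hx y hy)
  refine h1.congr ?_ ?_
  · filter_upwards [hc] with x hx
    rw [hx]
  · filter_upwards [hc] with x hx
    rw [hx]

/-! ### Functions in `H¹_{1/σ,0}(0,1)` as indefinite integrals -/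

/-- Extension by zero makes the primitive continuous on all of `ℝ`, although `g` is controlled only
on `(0,1)`. -/
theorem continuous_primitive_indicator {g : ℝ → ℝ} (hg : Integrable g leb) (x : ℝ) :
    Continuous fun t => ∫ s in x..t, (Ioo (0 : ℝ) 1).indicator g s := by
  have hgi : Integrable ((Ioo (0 : ℝ) 1).indicator g) :=
    (integrable_indicator_iff measurableSet_Ioo).2 hg
  exact intervalIntegral.continuous_primitive (fun _ _ => hgi.intervalIntegrable) x

theorem intervalIntegrable_of_integrable {g : ℝ → ℝ} (hg : Integrable g leb) {x y : ℝ}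
    (hx : x ∈ Icc (0 : ℝ) 1) (hy : y ∈ Icc (0 : ℝ) 1) : IntervalIntegrable g volume x y := by
  have h : IntervalIntegrable g volume 0 1 := by
    rw [intervalIntegrable_iff_integrableOn_Ioo_of_le zero_le_one]
    exact hg
  refine h.mono_set ?_
  rw [uIcc_of_le (zero_le_one (α := ℝ))]
  exact uIcc_subset_Icc hx hy

theorem integral_indicator_eq {g : ℝ → ℝ} {x y : ℝ}
    (hx : x ∈ Icc (0 : ℝ) 1) (hy : y ∈ Icc (0 : ℝ) 1) :
    ∫ s in x..y, (Ioo (0 : ℝ) 1).indicator g s = ∫ s in x..y, g s := by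
  refine intervalIntegral.integral_congr_ae ?_
  have h1 : ∀ᵐ t : ℝ, t ≠ 1 := by simp [ae_iff, measure_singleton]
  filter_upwards [h1] with s hs hs'
  have h2 := uIoc_subset_uIcc hs'
  have h3 : s ∈ Icc (0 : ℝ) 1 := uIcc_subset_Icc hx hy h2
  refine indicator_of_mem (s := Ioo (0 : ℝ) 1) ⟨?_, lt_of_le_of_ne h3.2 hs⟩ g
  rcases mem_uIoc.1 hs' with h | h
  · exact hx.1.trans_lt h.1
  · exact hy.1.trans_lt h.1

theorem hasWeakDeriv_primitive {g : ℝ → ℝ} (hg : Integrable g leb) :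
    HasWeakDeriv (fun t => ∫ s in (0 : ℝ)..t, (Ioo (0 : ℝ) 1).indicator g s) g := by
  refine HasWeakDeriv.of_isPrimitive fun x hx y hy => ?_
  have hx' := Ioo_subset_Icc_self hx
  have hy' := Ioo_subset_Icc_self hy
  have h := IsPrimitive.of_integral 0 (intervalIntegrable_of_integrable hg hx' hy')
    (intervalIntegrable_of_integrable hg (left_mem_Icc.2 zero_le_one) hx')
  refine h.congr (fun t ht => ?_) (Eventually.of_forall fun _ _ => rfl)
  rw [integral_indicator_eq (left_mem_Icc.2 zero_le_one)
    (Ioo_subset_Icc_self (uIcc_subset_Ioo hx hy ht))]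
  exact zero_add _

variable {a b : ℝ → ℝ}

theorem integrable_leb_of_memLp {g : ℝ → ℝ} (hg : MemLp g 2 leb) : Integrable g leb :=
  hg.integrable one_le_two

theorem ext_apply (u : C(Icc (0 : ℝ) 1, ℝ)) {x : ℝ} (hx : x ∈ Icc (0 : ℝ) 1) :
    ext u x = u ⟨x, hx⟩ := by
  rw [ext, projIcc_of_mem zero_le_one hx]

/-- Both sides are continuous with the same weak derivative, so they differ by a constant, which is
`u(0) = 0`. -/
theorem H1.ext_eq_integral (u : H1 a b) {x : ℝ} (hx : x ∈ Icc (0 : ℝ) 1) :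
    ext u.1 x = ∫ s in (0 : ℝ)..x, u.d s := by
  have hi := integrable_leb_of_memLp u.memLp_d
  obtain ⟨c, hc⟩ := u.hasWeakDeriv.exists_ae_eq (hasWeakDeriv_primitive hi)
  have h1 := eq_of_ae_eq ((continuous_primitive_indicator hi 0).const_add c) hc
  have h0 := h1 0
  rw [u.2.2.2] at h0
  simp only [Icc.coe_zero, intervalIntegral.integral_same, add_zero] at h0
  rw [ext_apply _ hx, h1, ← h0, zero_add]
  exact integral_indicator_eq (left_mem_Icc.2 zero_le_one) hx

theorem H1.isPrimitive (u : H1 a b) {x y : ℝ} (hx : x ∈ Icc (0 : ℝ) 1)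
    (hy : y ∈ Icc (0 : ℝ) 1) : IsPrimitive (ext u.1) u.d x y := by
  have hi := integrable_leb_of_memLp u.memLp_d
  refine (IsPrimitive.of_integral 0 (intervalIntegrable_of_integrable hi hx hy)
    (intervalIntegrable_of_integrable hi (left_mem_Icc.2 zero_le_one) hx)).congr
    (fun t ht => ?_) (Eventually.of_forall fun _ _ => rfl)
  rw [u.ext_eq_integral (uIcc_subset_Icc hx hy ht)]
  exact zero_add _

/-- Elements of `H¹_{1/σ,0}(0,1)` from their weak derivative. -/
theorem H1.exists_of_memLp {g : ℝ → ℝ} (hg : MemLp g 2 leb)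
    (h : MemLp (fun t => ∫ s in (0 : ℝ)..t, (Ioo (0 : ℝ) 1).indicator g s) 2 (wMeasure a b)) :
    ∃ u : H1 a b, u.d =ᵐ[leb] g ∧
      ext u.1 =ᵐ[leb] fun t => ∫ s in (0 : ℝ)..t, (Ioo (0 : ℝ) 1).indicator g s := by
  have hi := integrable_leb_of_memLp hg
  let v : C(Icc (0 : ℝ) 1, ℝ) :=
    ⟨fun t => ∫ s in (0 : ℝ)..t, (Ioo (0 : ℝ) 1).indicator g s,
      (continuous_primitive_indicator hi 0).comp continuous_subtype_val⟩
  have hv : ext v =ᵐ[leb] fun t => ∫ s in (0 : ℝ)..t, (Ioo (0 : ℝ) 1).indicator g s := by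
    filter_upwards [ae_restrict_mem measurableSet_Ioo] with t ht
    rw [ext_apply v (Ioo_subset_Icc_self ht)]
    rfl
  have hw : HasWeakDeriv (ext v) g :=
    (hasWeakDeriv_primitive hi).congr hv.symm (EventuallyEq.refl _ _)
  refine ⟨⟨v, ⟨g, hw, hg⟩, (memLp_congr_ae (ae_w_of_ae hv)).2 h, ?_⟩, hw.weakDeriv_ae, hv⟩
  exact intervalIntegral.integral_same

/-! ### The weight `1/σ` -/

theorem Admissible.sigma_pos (hab : Admissible a b) {x : ℝ} (hx : x ∈ Ioc (0 : ℝ) 1) :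
    0 < sigma a b x := div_pos (hab.a_pos x hx) (eta_pos a b x)

theorem Admissible.continuousOn_one_div_sigma (hab : Admissible a b) :
    ContinuousOn (fun x => 1 / sigma a b x) (Ioc 0 1) :=
  continuousOn_const.div ((hab.continuousOn_a.mono Ioc_subset_Icc_self).div
    (hab.continuousOn_eta.mono Ioc_subset_Icc_self) fun x _ => (eta_pos a b x).ne')
    fun _ hx => (hab.sigma_pos hx).ne'

theorem Admissible.aemeasurable_density (hab : Admissible a b) :
    AEMeasurable (fun x => ENNReal.ofReal (1 / sigma a b x)) leb :=
  ((hab.continuousOn_one_div_sigma.mono Ioo_subset_Ioc_self).aemeasurable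
    measurableSet_Ioo).ennreal_ofReal

theorem Admissible.toReal_density (hab : Admissible a b) :
    ∀ᵐ x ∂leb, (ENNReal.ofReal (1 / sigma a b x)).toReal = 1 / sigma a b x := by
  filter_upwards [ae_restrict_mem measurableSet_Ioo] with x hx
  exact ENNReal.toReal_ofReal (one_div_pos.2 (hab.sigma_pos (Ioo_subset_Ioc_self hx))).le

theorem Admissible.integrable_wMeasure_iff (hab : Admissible a b) {f : ℝ → ℝ} :
    Integrable f (wMeasure a b) ↔ Integrable (fun x => f x / sigma a b x) leb := by
  rw [wMeasure, integrable_withDensity_iff_integrable_smul₀' hab.aemeasurable_density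
    (Eventually.of_forall fun _ => ENNReal.ofReal_lt_top)]
  refine integrable_congr ?_
  filter_upwards [hab.toReal_density] with x hx
  rw [hx, smul_eq_mul]
  ring

theorem Admissible.integral_wMeasure (hab : Admissible a b) (f : ℝ → ℝ) :
    ∫ x, f x ∂(wMeasure a b) = ∫ x in Ioo (0 : ℝ) 1, f x / sigma a b x := by
  rw [wMeasure, integral_withDensity_eq_integral_toReal_smul₀ hab.aemeasurable_density
    (Eventually.of_forall fun _ => ENNReal.ofReal_lt_top)]
  refine integral_congr_ae ?_
  filter_upwards [hab.toReal_density] with x hx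
  rw [hx, smul_eq_mul]
  ring

theorem Admissible.inner_toLp (hab : Admissible a b) {f g : ℝ → ℝ}
    (hf : MemLp f 2 (wMeasure a b)) (hg : MemLp g 2 (wMeasure a b)) :
    ⟪hf.toLp f, hg.toLp g⟫_ℝ = ∫ x in Ioo (0 : ℝ) 1, f x * g x / sigma a b x := by
  rw [L2.inner_def, ← hab.integral_wMeasure fun x => f x * g x]
  refine integral_congr_ae ?_
  filter_upwards [hf.coeFn_toLp, hg.coeFn_toLp] with x h1 h2
  rw [h1, h2, real_inner_eq_re_inner]
  simp [mul_comm]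

theorem Admissible.integrable_mul_div_sigma (hab : Admissible a b) {f g : ℝ → ℝ}
    (hf : MemLp f 2 (wMeasure a b)) (hg : MemLp g 2 (wMeasure a b)) :
    Integrable (fun x => f x * g x / sigma a b x) leb :=
  hab.integrable_wMeasure_iff.1 (hf.integrable_mul hg)

theorem uIcc_subset_Ioc {x y : ℝ} (hx : x ∈ Ioc (0 : ℝ) 1) (hy : y ∈ Ioc (0 : ℝ) 1) :
    uIcc x y ⊆ Ioc 0 1 := ordConnected_Ioc.uIcc_subset hx hy

theorem ae_restrict_uIoc_of_ae_leb {p : ℝ → Prop} (h : ∀ᵐ x ∂leb, p x) {x y : ℝ}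
    (hx : x ∈ Icc (0 : ℝ) 1) (hy : y ∈ Icc (0 : ℝ) 1) : ∀ᵐ t, t ∈ uIoc x y → p t := by
  have h1 : ∀ᵐ t : ℝ, t ≠ 1 := by simp [ae_iff, measure_singleton]
  filter_upwards [h1, (ae_restrict_iff' measurableSet_Ioo).1 h] with t ht hp hxy
  have h3 : t ∈ Icc (0 : ℝ) 1 := uIcc_subset_Icc hx hy (uIoc_subset_uIcc hxy)
  refine hp ⟨?_, lt_of_le_of_ne h3.2 ht⟩
  rcases mem_uIoc.1 hxy with h | h
  · exact hx.1.trans_lt h.1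
  · exact hy.1.trans_lt h.1

/-- Away from `0`, `|f|/σ ≤ (f² + 1)/σ`, where `f²/σ` is integrable and `1/σ` is continuous up to
and including `1`. This is what gives the flux a value at `1`. -/
theorem Admissible.intervalIntegrable_div_sigma (hab : Admissible a b) {f : ℝ → ℝ}
    (hf : MemLp f 2 (wMeasure a b)) {x y : ℝ} (hx : x ∈ Ioc (0 : ℝ) 1)
    (hy : y ∈ Ioc (0 : ℝ) 1) :
    IntervalIntegrable (fun t => f t / sigma a b t) volume x y := by
  have hσ : IntervalIntegrable (fun t => 1 / sigma a b t) volume x y :=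
    (hab.continuousOn_one_div_sigma.mono (uIcc_subset_Ioc hx hy)).intervalIntegrable
  have hff : IntervalIntegrable (fun t => f t * f t / sigma a b t) volume x y :=
    intervalIntegrable_of_integrable (hab.integrable_mul_div_sigma hf hf)
      (Ioc_subset_Icc_self hx) (Ioc_subset_Icc_self hy)
  refine (hff.add hσ).mono_fun ?_ ?_
  · have hm : AEStronglyMeasurable f leb :=
      hf.aestronglyMeasurable.mono_ac (withDensity_absolutelyContinuous' hab.aemeasurable_density
        (by
          filter_upwards [ae_restrict_mem measurableSet_Ioo] with t ht
          rw [Ne, ENNReal.ofReal_eq_zero, not_le]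
          exact one_div_pos.2 (hab.sigma_pos (Ioo_subset_Ioc_self ht))))
    have hm2 : AEStronglyMeasurable (fun t => f t / sigma a b t) leb := by
      have := hm.mul ((hab.continuousOn_one_div_sigma.mono
        Ioo_subset_Ioc_self).aestronglyMeasurable measurableSet_Ioo)
      refine this.congr (Eventually.of_forall fun t => ?_)
      simp [div_eq_mul_inv]
    have hm3 : AEStronglyMeasurable (fun t => f t / sigma a b t)
        (volume.restrict (Ioc (0 : ℝ) 1)) := by
      rwa [leb, restrict_Ioo_eq_restrict_Ioc] at hm2
    refine hm3.mono_set fun t ht => ?_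
    exact uIcc_subset_Ioc hx hy (uIoc_subset_uIcc ht)
  · rw [Filter.EventuallyLE, ae_restrict_iff' measurableSet_uIoc]
    refine Eventually.of_forall fun t ht => ?_
    have hσt := hab.sigma_pos (uIcc_subset_Ioc hx hy (uIoc_subset_uIcc ht))
    rw [← add_div, norm_div, norm_div]
    gcongr
    rw [Real.norm_eq_abs, Real.norm_eq_abs]
    refine le_trans ?_ (le_abs_self _)
    nlinarith [sq_nonneg (|f t| - 1), sq_abs (f t), abs_nonneg (f t)]

/-! ### Bounds for `η` and for indefinite integrals -/

theorem Admissible.exists_le_eta (hab : Admissible a b) :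
    ∃ c : ℝ, 0 < c ∧ ∀ x ∈ Icc (0 : ℝ) 1, c ≤ eta a b x := by
  obtain ⟨x, _, hx⟩ := isCompact_Icc.exists_isMinOn (nonempty_Icc.2 zero_le_one)
    hab.continuousOn_eta
  exact ⟨eta a b x, eta_pos a b x, fun y hy => hx hy⟩

/-- Cauchy–Schwarz against the indicator of `(0, x]`. The decay `√x` is what removes the boundary
term at `0` in Green's formula. -/
theorem abs_integral_le_sqrt_mul (g : Lp ℝ 2 leb) {x : ℝ} (hx : x ∈ Icc (0 : ℝ) 1) :
    |∫ s in (0 : ℝ)..x, g s| ≤ √x * ‖g‖ := by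
  have hle : (volume.restrict (Ioo (0 : ℝ) 1)) (Ioc 0 x) ≤ ENNReal.ofReal x := by
    refine (Measure.restrict_apply_le _ _).trans ?_
    rw [Real.volume_Ioc, sub_zero]
  have hfin : (volume.restrict (Ioo (0 : ℝ) 1)) (Ioc 0 x) ≠ ⊤ :=
    (hle.trans_lt ENNReal.ofReal_lt_top).ne
  have h1 := L2.inner_indicatorConstLp_one (𝕜 := ℝ) measurableSet_Ioc hfin g
  have h2 : ∫ s in (0 : ℝ)..x, g s = ∫ s in Ioc 0 x, g s ∂leb := by
    rw [intervalIntegral.integral_of_le hx.1, Measure.restrict_restrict measurableSet_Ioc,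
      integral_Ioc_eq_integral_Ioo, ← integral_Ioc_eq_integral_Ioo]
    refine (setIntegral_congr_set ?_).symm
    have h3 : ∀ᵐ t : ℝ, t ≠ 1 := by simp [ae_iff, measure_singleton]
    filter_upwards [h3] with t ht
    refine propext ⟨fun h => h.1, fun h => ⟨h, h.1, lt_of_le_of_ne (h.2.trans hx.2) ht⟩⟩
  rw [h2, ← h1]
  refine (abs_real_inner_le_norm _ _).trans ?_
  gcongr
  rw [norm_indicatorConstLp two_ne_zero ENNReal.ofNat_ne_top, norm_one, one_mul,
    Real.sqrt_eq_rpow]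
  have h4 : (leb.real (Ioc 0 x)) ≤ x := ENNReal.toReal_le_of_le_ofReal hx.1 hle
  simpa using Real.rpow_le_rpow measureReal_nonneg h4 (by norm_num : (0 : ℝ) ≤ 1 / 2)

/-- The weak derivative as an element of `L²(0,1)`. -/
def H1.dL2 : H1 a b →ₗ[ℝ] Lp ℝ 2 leb where
  toFun u := u.memLp_d.toLp u.d
  map_add' u v := by
    rw [← MemLp.toLp_add, MemLp.toLp_eq_toLp_iff]
    exact H1.d_add u v
  map_smul' c u := by
    rw [RingHom.id_apply, ← MemLp.toLp_const_smul, MemLp.toLp_eq_toLp_iff]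
    exact H1.d_smul c u

theorem H1.ext_eq_integral_dL2 (u : H1 a b) {x : ℝ} (hx : x ∈ Icc (0 : ℝ) 1) :
    ext u.1 x = ∫ s in (0 : ℝ)..x, H1.dL2 u s := by
  rw [u.ext_eq_integral hx]
  refine intervalIntegral.integral_congr_ae ?_
  exact ae_restrict_uIoc_of_ae_leb (u.memLp_d.coeFn_toLp.symm)
    (left_mem_Icc.2 zero_le_one) hx

theorem H1.abs_ext_le (u : H1 a b) {x : ℝ} (hx : x ∈ Icc (0 : ℝ) 1) :
    |ext u.1 x| ≤ √x * ‖H1.dL2 u‖ := by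
  rw [u.ext_eq_integral_dL2 hx]
  exact abs_integral_le_sqrt_mul _ hx

theorem ext_one (u : C(Icc (0 : ℝ) 1, ℝ)) : ext u 1 = u 1 :=
  ext_apply u (right_mem_Icc.2 zero_le_one)

theorem H1.abs_one_le (u : H1 a b) : |u.one| ≤ ‖H1.dL2 u‖ := by
  have h := u.abs_ext_le (right_mem_Icc.2 zero_le_one)
  rw [Real.sqrt_one, one_mul, ext_one] at h
  exact h

/-- The Dirichlet form `∫ η u' v'`. -/
def dirichlet (u v : H1 a b) : ℝ := ∫ x in Ioo (0 : ℝ) 1, eta a b x * (u.d x * v.d x)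

theorem norm_dL2_sq (u : H1 a b) :
    ‖H1.dL2 u‖ ^ 2 = ∫ x in Ioo (0 : ℝ) 1, u.d x * u.d x := by
  rw [← real_inner_self_eq_norm_sq, L2.inner_def]
  refine integral_congr_ae ?_
  filter_upwards [u.memLp_d.coeFn_toLp] with x hx
  change ⟪u.memLp_d.toLp u.d x, u.memLp_d.toLp u.d x⟫_ℝ = _
  rw [hx]
  simp [sq]

theorem Admissible.exists_dirichlet_le (hab : Admissible a b) :
    ∃ C : ℝ, 0 ≤ C ∧ ∀ u : H1 a b, dirichlet u u ≤ C * ‖H1.dL2 u‖ ^ 2 := by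
  obtain ⟨C, hC⟩ := hab.exists_eta_le
  refine ⟨C, (norm_nonneg _).trans (hC 0 (left_mem_Icc.2 zero_le_one)), fun u => ?_⟩
  rw [norm_dL2_sq, dirichlet, ← integral_const_mul]
  refine integral_mono_ae (hab.integrable_eta_mul u.memLp_d u.memLp_d)
    ((u.memLp_d.integrable_mul u.memLp_d).const_mul C) ?_
  filter_upwards [ae_restrict_mem measurableSet_Ioo] with x hx
  exact mul_le_mul_of_nonneg_right ((le_abs_self _).trans (hC x (Ioo_subset_Icc_self hx)))
    (mul_self_nonneg _)

theorem Admissible.exists_le_dirichlet (hab : Admissible a b) :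
    ∃ c : ℝ, 0 < c ∧ ∀ u : H1 a b, c * ‖H1.dL2 u‖ ^ 2 ≤ dirichlet u u := by
  obtain ⟨c, hc, H⟩ := hab.exists_le_eta
  refine ⟨c, hc, fun u => ?_⟩
  rw [norm_dL2_sq, dirichlet, ← integral_const_mul]
  refine integral_mono_ae ((u.memLp_d.integrable_mul u.memLp_d).const_mul c)
    (hab.integrable_eta_mul u.memLp_d u.memLp_d) ?_
  filter_upwards [ae_restrict_mem measurableSet_Ioo] with x hx
  exact mul_le_mul_of_nonneg_right (H x (Ioo_subset_Icc_self hx)) (mul_self_nonneg _)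

theorem dirichlet_self_nonneg (u : H1 a b) : 0 ≤ dirichlet u u :=
  integral_nonneg fun x => mul_nonneg (eta_pos a b x).le (mul_self_nonneg _)

/-! ### The Hilbert space structure of `H¹_{1/σ,0}(0,1)` -/

variable {β : ℝ}

theorem EnergySpace.inner_eq (hab : Admissible a b) (hβ : 0 ≤ β) (Y Z : EnergySpace hab hβ) :
    ⟪Y, Z⟫_ℝ = dirichlet Y.1 Z.1 + ⟪Y.2, Z.2⟫_ℝ + β * (Y.1.one * Z.1.one) := rfl

/-- `H¹_{1/σ,0}(0,1)` with the norm `∫ η u'² + ∫ u²/σ + β u(1)²`. -/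
def FormDomain {a b : ℝ → ℝ} {β : ℝ} (_hab : Admissible a b) (_hβ : 0 ≤ β) : Type := H1 a b

namespace FormDomain

instance (hab : Admissible a b) (hβ : 0 ≤ β) : AddCommGroup (FormDomain hab hβ) :=
  inferInstanceAs (AddCommGroup (H1 a b))

instance (hab : Admissible a b) (hβ : 0 ≤ β) : Module ℝ (FormDomain hab hβ) :=
  inferInstanceAs (Module ℝ (H1 a b))

/-- The map `u ↦ (u, u)` into the energy space. -/
def diag (hab : Admissible a b) (hβ : 0 ≤ β) : FormDomain hab hβ →ₗ[ℝ] EnergySpace hab hβ where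
  toFun u := EnergySpace.mk hab hβ u (H1.toL2 u)
  map_add' _ _ := rfl
  map_smul' _ _ := rfl

/-- The inner product `∫ η u' v' + ∫ u v / σ + β u(1) v(1)`. -/
@[reducible] def core (hab : Admissible a b) (hβ : 0 ≤ β) :
    InnerProductSpace.Core ℝ (FormDomain hab hβ) where
  inner u v := ⟪diag hab hβ u, diag hab hβ v⟫_ℝ
  conj_inner_symm u v := by
    rw [conj_trivial]
    exact real_inner_comm _ _
  re_inner_nonneg u := by
    rw [RCLike.re_to_real]
    exact real_inner_self_nonneg
  add_left u v w := by rw [map_add, inner_add_left]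
  smul_left u v r := by rw [map_smul, real_inner_smul_left, conj_trivial]
  definite u h := by
    have := inner_self_eq_zero.1 h
    exact congrArg Prod.fst this

instance (hab : Admissible a b) (hβ : 0 ≤ β) : NormedAddCommGroup (FormDomain hab hβ) :=
  (core hab hβ).toNormedAddCommGroup

instance (hab : Admissible a b) (hβ : 0 ≤ β) : InnerProductSpace ℝ (FormDomain hab hβ) :=
  InnerProductSpace.ofCore (core hab hβ).toCore

variable {hab : Admissible a b} {hβ : 0 ≤ β}

/-- The underlying element of `H¹_{1/σ,0}(0,1)`. -/
def toH1 : FormDomain hab hβ ≃ₗ[ℝ] H1 a b := LinearEquiv.refl ℝ (H1 a b)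

theorem inner_eq (u v : FormDomain hab hβ) :
    ⟪u, v⟫_ℝ = dirichlet (toH1 u) (toH1 v) + ⟪H1.toL2 (toH1 u), H1.toL2 (toH1 v)⟫_ℝ
      + β * ((toH1 u).one * (toH1 v).one) := rfl

theorem norm_sq_eq (u : FormDomain hab hβ) :
    ‖u‖ ^ 2 = dirichlet (toH1 u) (toH1 u) + ‖H1.toL2 (toH1 u)‖ ^ 2
      + β * ((toH1 u).one * (toH1 u).one) := by
  rw [← real_inner_self_eq_norm_sq, inner_eq, real_inner_self_eq_norm_sq]

theorem norm_toL2_le (u : FormDomain hab hβ) : ‖H1.toL2 (toH1 u)‖ ≤ ‖u‖ := by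
  refine le_of_sq_le_sq ?_ (norm_nonneg _)
  have h := mul_nonneg hβ (mul_self_nonneg (toH1 u).one)
  rw [norm_sq_eq]
  linarith [dirichlet_self_nonneg (toH1 u)]

/-- The inclusion into `L²_{1/σ}(0,1)`. -/
def toL2 : FormDomain hab hβ →L[ℝ] L2w a b :=
  (H1.toL2 ∘ₗ toH1.toLinearMap).mkContinuous 1 fun u => by
    rw [one_mul]
    exact norm_toL2_le u

theorem toL2_apply (u : FormDomain hab hβ) : toL2 u = H1.toL2 (toH1 u) := rfl

theorem exists_norm_dL2_le (hab : Admissible a b) (hβ : 0 ≤ β) :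
    ∃ C : ℝ, ∀ u : FormDomain hab hβ, ‖H1.dL2 (toH1 u)‖ ≤ C * ‖u‖ := by
  obtain ⟨c, hc, H⟩ := hab.exists_le_dirichlet
  refine ⟨√(1 / c), fun u => ?_⟩
  refine le_of_sq_le_sq ?_ (by positivity)
  rw [mul_pow, Real.sq_sqrt (by positivity), norm_sq_eq, one_div, inv_mul_eq_div, le_div_iff₀ hc]
  have h := mul_nonneg hβ (mul_self_nonneg (toH1 u).one)
  nlinarith [H (toH1 u), sq_nonneg ‖H1.toL2 (toH1 u)‖]

/-- The weak derivative as a bounded operator. -/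
def dL2 : FormDomain hab hβ →L[ℝ] Lp ℝ 2 leb :=
  (H1.dL2 ∘ₗ toH1.toLinearMap).mkContinuousOfExistsBound (exists_norm_dL2_le hab hβ)

theorem dL2_apply (u : FormDomain hab hβ) : dL2 u = H1.dL2 (toH1 u) := rfl

/-- Evaluation at `1` as a bounded functional. -/
def evalOne : FormDomain hab hβ →L[ℝ] ℝ :=
  LinearMap.mkContinuousOfExistsBound
    { toFun := fun u => (toH1 u).one
      map_add' := fun _ _ => rfl
      map_smul' := fun _ _ => rfl } <| by
    obtain ⟨C, hC⟩ := exists_norm_dL2_le hab hβ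
    exact ⟨C, fun u => ((toH1 u).abs_one_le).trans (hC u)⟩

/-- Since `η` is bounded and `|u(1)| ≤ ‖u'‖`, convergence of `u'` in `L²` and of `u` in `L²_{1/σ}`
suffices for convergence in the form norm. -/
theorem exists_norm_sq_le (hab : Admissible a b) (hβ : 0 ≤ β) :
    ∃ C : ℝ, ∀ u : FormDomain hab hβ, ‖u‖ ^ 2 ≤ C * ‖dL2 u‖ ^ 2 + ‖toL2 u‖ ^ 2 := by
  obtain ⟨C, hC, H⟩ := hab.exists_dirichlet_le
  refine ⟨C + β, fun u => ?_⟩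
  rw [norm_sq_eq, dL2_apply, toL2_apply]
  have h1 : (toH1 u).one * (toH1 u).one ≤ ‖H1.dL2 (toH1 u)‖ ^ 2 := by
    have h := (toH1 u).abs_one_le
    nlinarith [abs_mul_abs_self (toH1 u).one, abs_nonneg (toH1 u).one]
  nlinarith [H (toH1 u), mul_le_mul_of_nonneg_left h1 hβ]

/-- Along a Cauchy sequence `u'` tends to some `g` in `L²` and `u` to some `w` in `L²_{1/σ}`. The
values of `u` converge pointwise to the primitive of `g`, and an a.e. convergent subsequence
identifies `w` with it; so the primitive lies in the space. -/
instance (hab : Admissible a b) (hβ : 0 ≤ β) : CompleteSpace (FormDomain hab hβ) := by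
  refine Metric.complete_of_cauchySeq_tendsto fun u hu => ?_
  obtain ⟨g, hg⟩ : ∃ g, Tendsto (fun n => dL2 (u n)) atTop (𝓝 g) :=
    cauchySeq_tendsto_of_complete
      ((dL2 (hab := hab) (hβ := hβ)).uniformContinuous.comp_cauchySeq hu)
  obtain ⟨w, hw⟩ : ∃ w, Tendsto (fun n => toL2 (u n)) atTop (𝓝 w) :=
    cauchySeq_tendsto_of_complete
      ((toL2 (hab := hab) (hβ := hβ)).uniformContinuous.comp_cauchySeq hu)
  have hgL := Lp.memLp g
  have hpt : ∀ x ∈ Icc (0 : ℝ) 1,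
      Tendsto (fun n => ext (toH1 (u n)).1 x) atTop (𝓝 (∫ s in (0 : ℝ)..x, g s)) := by
    intro x hx
    rw [tendsto_iff_norm_sub_tendsto_zero]
    refine squeeze_zero (fun _ => norm_nonneg _) (fun n => ?_)
      (tendsto_iff_norm_sub_tendsto_zero.1 hg)
    rw [(toH1 (u n)).ext_eq_integral_dL2 hx, ← intervalIntegral.integral_sub
      (intervalIntegrable_of_integrable (integrable_leb_of_memLp (Lp.memLp _))
        (left_mem_Icc.2 zero_le_one) hx)
      (intervalIntegrable_of_integrable (integrable_leb_of_memLp hgL)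
        (left_mem_Icc.2 zero_le_one) hx)]
    have h1 : ∫ s in (0 : ℝ)..x, (H1.dL2 (toH1 (u n)) s - g s)
        = ∫ s in (0 : ℝ)..x, (H1.dL2 (toH1 (u n)) - g : Lp ℝ 2 leb) s := by
      refine intervalIntegral.integral_congr_ae ?_
      exact ae_restrict_uIoc_of_ae_leb (Lp.coeFn_sub _ _).symm (left_mem_Icc.2 zero_le_one) hx
    rw [h1]
    refine (abs_integral_le_sqrt_mul _ hx).trans ?_
    exact mul_le_of_le_one_left (norm_nonneg _) (Real.sqrt_le_one.2 hx.2)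
  obtain ⟨ns, hns, hns'⟩ := (tendstoInMeasure_of_tendsto_Lp hw).exists_seq_tendsto_ae
  have hw_eq : w =ᵐ[wMeasure a b]
      fun t => ∫ s in (0 : ℝ)..t, (Ioo (0 : ℝ) 1).indicator g s := by
    have hmem : ∀ᵐ t ∂(wMeasure a b), t ∈ Ioo (0 : ℝ) 1 :=
      ae_w_of_ae (ae_restrict_mem measurableSet_Ioo)
    have hcoe : ∀ᵐ t ∂(wMeasure a b), ∀ n, toL2 (u n) t = ext (toH1 (u n)).1 t :=
      ae_all_iff.2 fun n => (toH1 (u n)).2.2.1.coeFn_toLp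
    filter_upwards [hns', hmem, hcoe] with t h1 h2 h3
    rw [integral_indicator_eq (left_mem_Icc.2 zero_le_one) (Ioo_subset_Icc_self h2)]
    refine tendsto_nhds_unique h1 ?_
    simp only [h3]
    exact (hpt t (Ioo_subset_Icc_self h2)).comp hns.tendsto_atTop
  obtain ⟨U, hU1, hU2⟩ := H1.exists_of_memLp hgL ((memLp_congr_ae hw_eq).1 (Lp.memLp w))
  let V : FormDomain hab hβ := toH1.symm U
  have hV1 : dL2 V = g := by
    change U.memLp_d.toLp U.d = g
    refine Lp.ext ?_
    exact U.memLp_d.coeFn_toLp.trans hU1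
  have hV2 : toL2 V = w := by
    change U.2.2.1.toLp (ext U.1) = w
    refine Lp.ext ?_
    have hU3 : ext U.1 =ᵐ[wMeasure a b]
        fun t => ∫ s in (0 : ℝ)..t, (Ioo (0 : ℝ) 1).indicator g s := ae_w_of_ae hU2
    exact U.2.2.1.coeFn_toLp.trans (hU3.trans hw_eq.symm)
  obtain ⟨C, hC⟩ := exists_norm_sq_le hab hβ
  refine ⟨V, tendsto_iff_norm_sub_tendsto_zero.2 ?_⟩
  have hlim : Tendsto (fun n => √(C * ‖dL2 (u n - V)‖ ^ 2 + ‖toL2 (u n - V)‖ ^ 2)) atTop (𝓝 0) := by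
    simp only [map_sub, hV1, hV2]
    have h1 := ((tendsto_iff_norm_sub_tendsto_zero.1 hg).pow 2).const_mul C
    have h2 := (tendsto_iff_norm_sub_tendsto_zero.1 hw).pow 2
    simpa using (h1.add h2).sqrt
  exact squeeze_zero (fun _ => norm_nonneg _) (fun n => Real.le_sqrt_of_sq_le (hC _)) hlim

end FormDomain

/-! ### The flux `η u'` -/

theorem Admissible.continuousOn_div (hab : Admissible a b) :
    ContinuousOn (fun x => b x / a x) (Ioo 0 1) :=
  (hab.continuousOn_b.mono Ioo_subset_Icc_self).div (hab.continuousOn_a.mono Ioo_subset_Icc_self)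
    fun x hx => (hab.a_pos x (Ioo_subset_Ioc_self hx)).ne'

theorem Admissible.hasDerivAt_eta (hab : Admissible a b) {x : ℝ} (hx : x ∈ Ioo (0 : ℝ) 1) :
    HasDerivAt (eta a b) (eta a b x * (b x / a x)) x :=
  (intervalIntegral.integral_hasDerivAt_right
    (hab.intervalIntegrable (by constructor <;> norm_num) (Ioo_subset_Icc_self hx))
    (hab.continuousOn_div.stronglyMeasurableAtFilter isOpen_Ioo x hx)
    (hab.continuousOn_div.continuousAt (isOpen_Ioo.mem_nhds hx))).exp

theorem Admissible.memLp_eta_mul (hab : Admissible a b) {f : ℝ → ℝ} (hf : MemLp f 2 leb) :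
    MemLp (fun x => eta a b x * f x) 2 leb := by
  obtain ⟨C, hC⟩ := hab.exists_eta_le
  refine hf.of_le_mul (c := C) ?_ ?_
  · exact ((hab.continuousOn_eta.mono Ioo_subset_Icc_self).aestronglyMeasurable
      measurableSet_Ioo).mul hf.1
  · filter_upwards [ae_restrict_mem measurableSet_Ioo] with x hx
    rw [norm_mul]
    gcongr
    exact hC x (Ioo_subset_Icc_self hx)

/-- The divergence form of `A`: as `η' = η b/a`, `(ηu')' = ηu'' + (η b/a)u' = Au/σ`. -/
theorem hasWeakDeriv_flux (hab : Admissible a b) (u : H2 a b) :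
    HasWeakDeriv (fun x => eta a b x * u.1.d x)
      (fun x => (a x * u.1.dd x + b x * u.1.d x) / sigma a b x) := by
  have h := (hasWeakDeriv_weakDeriv u.2.1).mul_of_hasDerivAt (fun x hx => hab.hasDerivAt_eta hx)
    ((hab.continuousOn_eta.mono Ioo_subset_Icc_self).mul hab.continuousOn_div)
  refine h.congr (EventuallyEq.refl _ _) ?_
  filter_upwards [ae_restrict_mem measurableSet_Ioo] with x hx
  have ha := (hab.a_pos x (Ioo_subset_Ioc_self hx)).ne'
  have he := (eta_pos a b x).ne'
  rw [sigma, H1.dd]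
  field_simp
  ring

/-- If the weak derivative of `F` is `f/σ` with `f ∈ L²_{1/σ}(0,1)`, then `F` has a representative
that is an indefinite integral up to the endpoint `1`. -/
theorem Admissible.exists_isPrimitive_to_one (hab : Admissible a b) {F f : ℝ → ℝ}
    (hf : MemLp f 2 (wMeasure a b)) (h : HasWeakDeriv F fun x => f x / sigma a b x) :
    ∃ p : ℝ → ℝ, (∀ x ∈ Ioc (0 : ℝ) 1, IsPrimitive p (fun t => f t / sigma a b t) x 1) ∧
      p =ᵐ[leb] F := by
  obtain ⟨c, hc⟩ := h.exists_primitive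
  refine ⟨_, fun x hx => ?_, hc.symm⟩
  exact IsPrimitive.of_integral c
    (hab.intervalIntegrable_div_sigma hf hx (right_mem_Ioc.2 one_pos))
    (hab.intervalIntegrable_div_sigma hf (by constructor <;> norm_num) hx)

theorem continuousOn_Ioc_of_isPrimitive {p k : ℝ → ℝ}
    (h : ∀ x ∈ Ioc (0 : ℝ) 1, IsPrimitive p k x 1) : ContinuousOn p (Ioc 0 1) := by
  intro x hx
  have hx2 : x / 2 ∈ Ioc (0 : ℝ) 1 := ⟨by linarith [hx.1], by linarith [hx.2, hx.1]⟩
  have h1 := (h _ hx2).continuousOn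
  rw [uIcc_of_le hx2.2] at h1
  refine (h1 x ⟨by linarith [hx.1], hx.2⟩).mono_of_mem_nhdsWithin ?_
  refine mem_nhdsWithin.2 ⟨Ioi (x / 2), isOpen_Ioi, by simp [hx.1], ?_⟩
  exact fun t ht => ⟨(mem_Ioi.1 ht.1).le, ht.2.2⟩

theorem eq_at_one_of_ae_eq {p q : ℝ → ℝ} (hp : ContinuousOn p (Ioc 0 1))
    (hq : ContinuousOn q (Ioc 0 1)) (h : p =ᵐ[leb] q) : p 1 = q 1 := by
  have h1 : EqOn p q (Ioo 0 1) := Measure.eqOn_open_of_ae_eq h isOpen_Ioo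
    (hp.mono Ioo_subset_Ioc_self) (hq.mono Ioo_subset_Ioc_self)
  have hne : (𝓝[Ioo (0 : ℝ) 1] 1).NeBot := by
    rw [← mem_closure_iff_nhdsWithin_neBot, closure_Ioo zero_ne_one]
    exact right_mem_Icc.2 zero_le_one
  have hp1 := ((hp 1 (right_mem_Ioc.2 one_pos)).mono Ioo_subset_Ioc_self).tendsto
  have hq1 := ((hq 1 (right_mem_Ioc.2 one_pos)).mono Ioo_subset_Ioc_self).tendsto
  refine tendsto_nhds_unique (hp1.congr' ?_) hq1
  filter_upwards [self_mem_nhdsWithin] with t ht using h1 ht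

/-! ### Green's formula -/

/-- If `p ∈ L²(0,1)` and `|f(x)| ≤ C √x`, then `p f` has no nonzero limit at `0`. -/
theorem eq_zero_of_tendsto_mul {p f : ℝ → ℝ} {C L : ℝ} (hp : MemLp p 2 leb)
    (hf : ∀ x ∈ Ioo (0 : ℝ) 1, |f x| ≤ √x * C)
    (h : Tendsto (fun x => p x * f x) (𝓝[>] 0) (𝓝 L)) : L = 0 := by
  by_contra hL
  have hL2 : 0 < |L| / 2 := by positivity
  have hev : ∀ᶠ x in 𝓝[>] (0 : ℝ), |L| / 2 < |p x * f x| :=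
    h.abs.eventually (lt_mem_nhds (by linarith [abs_pos.2 hL]))
  obtain ⟨δ, hδ, hsub⟩ := mem_nhdsGT_iff_exists_Ioo_subset.1 hev
  have hδ0 : (0 : ℝ) < δ := hδ
  set r := min δ 1
  have hr : 0 < r := lt_min hδ0 one_pos
  -- Near `0`, `|L|/2 < |p f| ≤ |p| √x C`; squaring bounds `1/x` by a multiple of the integrable
  -- function `p²`.
  have hint : IntegrableOn (fun x : ℝ => x⁻¹) (Ioo 0 r) := by
    have hp1 : IntegrableOn (fun x => (C / (|L| / 2)) ^ 2 * p x ^ 2) (Ioo 0 1) :=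
      hp.integrable_sq.const_mul _
    have hp2 := hp1.mono_set (Ioo_subset_Ioo le_rfl (min_le_right δ 1))
    refine Integrable.mono' hp2 measurable_inv.aestronglyMeasurable ?_
    filter_upwards [ae_restrict_mem measurableSet_Ioo] with x hx
    have hx1 : x ∈ Ioo (0 : ℝ) 1 := ⟨hx.1, hx.2.trans_le (min_le_right _ _)⟩
    have h1 : |L| / 2 < |p x * f x| := hsub ⟨hx.1, hx.2.trans_le (min_le_left _ _)⟩
    rw [abs_mul] at h1
    have h2 : |L| / 2 ≤ |p x| * (√x * C) :=
      h1.le.trans (mul_le_mul_of_nonneg_left (hf x hx1) (abs_nonneg _))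
    have h3 : (|L| / 2) ^ 2 ≤ p x ^ 2 * (x * C ^ 2) := by
      have h4 := pow_le_pow_left₀ hL2.le h2 2
      rwa [mul_pow, sq_abs, mul_pow, Real.sq_sqrt hx.1.le] at h4
    rw [norm_inv, Real.norm_of_nonneg hx.1.le, div_pow, div_mul_eq_mul_div,
      le_div_iff₀ (by positivity), inv_mul_le_iff₀ hx.1]
    linarith
  have h5 : IntervalIntegrable (fun x : ℝ => x⁻¹) volume 0 r :=
    (intervalIntegrable_iff_integrableOn_Ioo_of_le hr.le).2 hint
  rcases intervalIntegrable_inv_iff.1 h5 with h6 | h6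
  · exact hr.ne h6
  · exact h6 left_mem_uIcc

/-- Integrate by parts on `[x, 1]` and let `x → 0`. The boundary term `p(x)φ(x)` has a limit because
the integrand is integrable on `(0,1)`, and `eq_zero_of_tendsto_mul` makes that limit `0`. -/
theorem Admissible.green (hab : Admissible a b) {p f : ℝ → ℝ}
    (hp : ∀ x ∈ Ioc (0 : ℝ) 1, IsPrimitive p (fun t => f t / sigma a b t) x 1)
    (hp2 : MemLp p 2 leb) (hf : MemLp f 2 (wMeasure a b)) (φ : H1 a b) :
    (∫ x in Ioo (0 : ℝ) 1, p x * φ.d x)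
      + ∫ x in Ioo (0 : ℝ) 1, f x * ext φ.1 x / sigma a b x = p 1 * φ.one := by
  have i1 : Integrable (fun x => p x * φ.d x) leb := hp2.integrable_mul φ.memLp_d
  have i2 := hab.integrable_mul_div_sigma hf φ.2.2.1
  rw [← integral_add i1 i2]
  set k : ℝ → ℝ := fun x => p x * φ.d x + f x * ext φ.1 x / sigma a b x with hk
  have ik : Integrable k leb := i1.add i2
  have h01 : (1 : ℝ) ∈ Icc (0 : ℝ) 1 := right_mem_Icc.2 zero_le_one
  have hparts : ∀ x ∈ Ioc (0 : ℝ) 1,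
      ∫ t in x..1, k t = p 1 * φ.one - p x * ext φ.1 x := by
    intro x hx
    have h := (hp x hx).integral_mul_add_mul (φ.isPrimitive (Ioc_subset_Icc_self hx) h01)
    rw [ext_one] at h
    rw [H1.one, ← h]
    refine intervalIntegral.integral_congr fun t _ => ?_
    simp only [hk]
    ring
  have hcont : Tendsto (fun x => ∫ t in x..1, k t) (𝓝[>] 0) (𝓝 (∫ t in (0 : ℝ)..1, k t)) := by
    have hc := ((continuous_primitive_indicator ik 1).neg.tendsto 0).mono_left
      (nhdsWithin_le_nhds (s := Ioi (0 : ℝ)))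
    simp only [Pi.neg_apply] at hc
    rw [← intervalIntegral.integral_symm, integral_indicator_eq (by simp) h01] at hc
    refine hc.congr' ?_
    filter_upwards [Ioo_mem_nhdsGT (zero_lt_one (α := ℝ))] with x hx
    rw [Pi.neg_apply, ← intervalIntegral.integral_symm,
      integral_indicator_eq (Ioo_subset_Icc_self hx) h01]
  have hlim : Tendsto (fun x => p x * ext φ.1 x) (𝓝[>] 0)
      (𝓝 (p 1 * φ.one - ∫ t in (0 : ℝ)..1, k t)) := by
    refine (hcont.const_sub _).congr' ?_
    filter_upwards [Ioo_mem_nhdsGT (zero_lt_one (α := ℝ))] with x hx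
    rw [hparts x (Ioo_subset_Ioc_self hx)]
    ring
  have h0 := eq_zero_of_tendsto_mul hp2 (fun x hx => φ.abs_ext_le (Ioo_subset_Icc_self hx)) hlim
  rw [intervalIntegral.integral_of_le zero_le_one, integral_Ioc_eq_integral_Ioo] at h0
  linarith

/-- Green's formula for `A`. -/
theorem dirichlet_add_inner_opA (hab : Admissible a b) (u : H2 a b) (φ : H1 a b) {c : ℝ}
    (hc : HasValueAtOne (fun x => eta a b x * u.1.d x) c) :
    dirichlet u.1 φ + ⟪opA a b u, H1.toL2 φ⟫_ℝ = c * φ.one := by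
  obtain ⟨p, hp, hpe⟩ := hab.exists_isPrimitive_to_one u.2.2 (hasWeakDeriv_flux hab u)
  obtain ⟨q, hq, hqe, hq1⟩ := hc
  have hp1 : p 1 = c := by
    rw [← hq1]
    exact eq_at_one_of_ae_eq (continuousOn_Ioc_of_isPrimitive hp) hq (hpe.trans hqe.symm)
  have hp2 : MemLp p 2 leb := (memLp_congr_ae hpe).2 (hab.memLp_eta_mul u.1.memLp_d)
  have h := hab.green hp hp2 u.2.2 φ
  rw [hp1] at h
  rw [← h]
  congr 1
  · refine integral_congr_ae ?_
    filter_upwards [hpe] with x hx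
    rw [hx]
    ring
  · exact hab.inner_toLp u.2.2 φ.2.2.1

/-! ### Dissipativity -/

theorem mem_graph_waveOperator_iff (hab : Admissible a b) (hβ : 0 ≤ β)
    (Y Z : EnergySpace hab hβ) : (Y, Z) ∈ (waveOperator hab hβ).graph ↔
      ∃ q : bcPairs a b β, bcInclusion hab hβ q = Y ∧ bcAction hab hβ q = Z := by
  have key : ∀ (q : bcPairs a b β) (h : bcInclusion hab hβ q ∈ (waveOperator hab hβ).domain),
      waveOperator hab hβ ⟨bcInclusion hab hβ q, h⟩ = bcAction hab hβ q := by
    intro q h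
    change bcAction hab hβ ((LinearEquiv.ofInjective (bcInclusion hab hβ)
      (bcInclusion_injective hab hβ)).symm ⟨bcInclusion hab hβ q, h⟩) = _
    congr 1
    rw [LinearEquiv.symm_apply_eq]
    rfl
  rw [LinearPMap.mem_graph_iff]
  constructor
  · rintro ⟨⟨_, q, rfl⟩, rfl, h2⟩
    exact ⟨q, rfl, by rw [← key q ⟨q, rfl⟩]; exact h2⟩
  · rintro ⟨q, rfl, rfl⟩
    exact ⟨⟨bcInclusion hab hβ q, q, rfl⟩, rfl, key q ⟨q, rfl⟩⟩

theorem dirichlet_comm (u v : H1 a b) : dirichlet u v = dirichlet v u := by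
  simp only [dirichlet, mul_comm (u.d _)]

/-- Green's formula with `φ = v` leaves `(c + β u(1)) v(1)`, where `c = (ηu')(1)`; the boundary
condition turns this into `-v(1)²`. -/
theorem isDissipative_waveOperator (hab : Admissible a b) (hβ : 0 ≤ β) :
    IsDissipative (waveOperator hab hβ) := by
  intro x
  obtain ⟨⟨⟨u, v⟩, c, hc, hcv⟩, h1, h2⟩ := (mem_graph_waveOperator_iff hab hβ _ _).1
    ((waveOperator hab hβ).mem_graph x)
  rw [← h1, ← h2, EnergySpace.inner_eq]
  change dirichlet v u.1 + ⟪opA a b u, H1.toL2 v⟫_ℝ + β * (v.one * u.1.one) ≤ 0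
  rw [dirichlet_comm, dirichlet_add_inner_opA hab u v hc]
  have hc' : c = -v.one - β * u.1.one := by
    have : c + v.one + β * u.1.one = 0 := hcv
    linarith
  rw [hc']
  nlinarith [sq_nonneg v.one]

/-! ### Smooth elements of `H¹_{1/σ,0}(0,1)` -/

theorem Admissible.memLp_wMeasure_of_continuous (hab : Admissible a b) {φ : ℝ → ℝ}
    (hφ : Continuous φ) {δ : ℝ} (hδ : 0 < δ) (h0 : ∀ x ≤ δ, φ x = 0) :
    MemLp φ 2 (wMeasure a b) := by
  rw [memLp_two_iff_integrable_sq hφ.aestronglyMeasurable, hab.integrable_wMeasure_iff]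
  have h1 : IntegrableOn (fun x => φ x ^ 2 / sigma a b x) (Icc δ 1) := by
    refine ContinuousOn.integrableOn_Icc ?_
    have h2 := (hφ.pow 2).continuousOn.mul (hab.continuousOn_one_div_sigma.mono
      (fun x hx => ⟨hδ.trans_le hx.1, hx.2⟩ : Icc δ 1 ⊆ Ioc 0 1))
    refine h2.congr fun x _ => ?_
    simp [div_eq_mul_inv]
  refine IntegrableOn.of_forall_sdiff_eq_zero h1 measurableSet_Ioo fun x hx => ?_
  have hx' : x ≤ δ := by
    by_contra hc
    exact hx.2 ⟨(not_le.1 hc).le, hx.1.2.le⟩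
  rw [h0 x hx']
  simp

/-- The supply of test functions: vanishing near `0` avoids the singularity of `1/σ`, while the
value at `1` stays free. -/
theorem Admissible.exists_h1_of_contDiff (hab : Admissible a b) {φ : ℝ → ℝ}
    (hφ : ContDiff ℝ 1 φ) {δ : ℝ} (hδ : 0 < δ) (h0 : ∀ x ≤ δ, φ x = 0) :
    ∃ v : H1 a b, (∀ x ∈ Icc (0 : ℝ) 1, ext v.1 x = φ x) ∧ v.d =ᵐ[leb] deriv φ := by
  have hcd : Continuous (deriv φ) := hφ.continuous_deriv le_rfl
  let u : C(Icc (0 : ℝ) 1, ℝ) := ⟨fun x => φ x, hφ.continuous.comp continuous_subtype_val⟩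
  have hu : ∀ x ∈ Icc (0 : ℝ) 1, ext u x = φ x := fun x hx => by
    rw [ext_apply u hx]
    rfl
  have hue : φ =ᵐ[leb] ext u := by
    filter_upwards [ae_restrict_mem measurableSet_Ioo] with x hx
    rw [hu x (Ioo_subset_Icc_self hx)]
  have hw : HasWeakDeriv (ext u) (deriv φ) :=
    (HasWeakDeriv.of_isPrimitive fun x _ y _ => IsPrimitive.of_hasDerivAt
      (fun t _ => (hφ.differentiable one_ne_zero t).hasDerivAt) hcd.continuousOn).congr hue
      (EventuallyEq.refl _ _)
  have hd : MemLp (deriv φ) 2 leb := by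
    obtain ⟨C, hC⟩ := isCompact_Icc.exists_bound_of_continuousOn
      (hcd.continuousOn (s := Icc (0 : ℝ) 1))
    refine MemLp.of_bound hcd.aestronglyMeasurable C ?_
    filter_upwards [ae_restrict_mem measurableSet_Ioo] with x hx
    exact hC x (Ioo_subset_Icc_self hx)
  have hL : MemLp (ext u) 2 (wMeasure a b) :=
    (memLp_congr_ae (ae_w_of_ae hue)).1 (hab.memLp_wMeasure_of_continuous hφ.continuous hδ h0)
  refine ⟨⟨u, ⟨_, hw, hd⟩, hL, ?_⟩, hu, hw.weakDeriv_ae⟩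
  exact h0 0 hδ.le

/-! ### Weak solutions -/

theorem dirichlet_eq_of_ae {u v : H1 a b} {g : ℝ → ℝ} (h : v.d =ᵐ[leb] g) :
    dirichlet u v = ∫ x in Ioo (0 : ℝ) 1, eta a b x * u.d x * g x := by
  refine integral_congr_ae ?_
  filter_upwards [h] with x hx
  rw [hx, mul_assoc]

theorem Admissible.inner_toL2 (hab : Admissible a b) (q : L2w a b) (φ : H1 a b) :
    ⟪q, H1.toL2 φ⟫_ℝ = ∫ x in Ioo (0 : ℝ) 1, q x * ext φ.1 x / sigma a b x := by
  have h := hab.inner_toLp (Lp.memLp q) φ.2.2.1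
  rwa [Lp.toLp_coeFn] at h

/-- A weak solution of `A u = q` has flux `η u'` with weak derivative `q/σ`. -/
theorem hasWeakDeriv_flux_of_weak (hab : Admissible a b) {u : H1 a b} {q : L2w a b} {d : ℝ}
    (h : ∀ φ : H1 a b, dirichlet u φ + ⟪q, H1.toL2 φ⟫_ℝ = d * φ.one) :
    HasWeakDeriv (fun x => eta a b x * u.d x) (fun x => q x / sigma a b x) := by
  refine ⟨?_, ?_, fun φ hφ => ?_⟩
  · have hi : IntegrableOn (fun x => eta a b x * u.d x) (Ioo 0 1) :=
      integrable_leb_of_memLp (hab.memLp_eta_mul u.memLp_d)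
    exact hi.locallyIntegrableOn
  · exact locallyIntegrableOn_of_intervalIntegrable fun x hx y hy =>
      hab.intervalIntegrable_div_sigma (Lp.memLp q) (Ioo_subset_Ioc_self hx)
        (Ioo_subset_Ioc_self hy)
  · obtain ⟨m, hm, M, hM, -, hs⟩ := hφ.exists_support_subset
    have hφ0 : ∀ x, x ∉ Ioo m M → φ x = 0 := fun x hx =>
      image_eq_zero_of_notMem_tsupport fun h' => hx (hs h')
    obtain ⟨v, hv, hvd⟩ := hab.exists_h1_of_contDiff (φ := φ) (hφ.1.of_le (by simp)) hm.1
      fun x hx => hφ0 x fun h' => absurd h'.1 (not_lt.2 hx)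
    have h1 := h v
    have hv1 : v.one = 0 := by
      rw [H1.one, ← ext_one, hv 1 (right_mem_Icc.2 zero_le_one)]
      exact hφ0 1 fun h' => absurd h'.2 (not_lt.2 hM.2.le)
    rw [hv1, mul_zero, dirichlet_eq_of_ae hvd, hab.inner_toL2] at h1
    have h2 : ∫ x in Ioo (0 : ℝ) 1, q x * ext v.1 x / sigma a b x
        = ∫ x in Ioo (0 : ℝ) 1, q x / sigma a b x * φ x := by
      refine setIntegral_congr_fun measurableSet_Ioo fun x hx => ?_
      rw [hv x (Ioo_subset_Icc_self hx)]
      ring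
    rw [h2] at h1
    exact eq_neg_of_add_eq_zero_left h1

/-- Dividing the flux by `η` gives `u'' = -(b/a)u' + q/a`, that is `Au = q`. The boundary value is
the natural condition of the form: compare the weak equation with Green's formula for one test
function equal to `1` at `1`. -/
theorem exists_h2_of_weak (hab : Admissible a b) {u : H1 a b} {q : L2w a b} {d : ℝ}
    (h : ∀ φ : H1 a b, dirichlet u φ + ⟪q, H1.toL2 φ⟫_ℝ = d * φ.one) :
    ∃ hu : u ∈ H2 a b, opA a b ⟨u, hu⟩ = q ∧
      HasValueAtOne (fun x => eta a b x * u.d x) d := by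
  have hflux := hasWeakDeriv_flux_of_weak hab h
  have hη : ∀ x ∈ Ioo (0 : ℝ) 1,
      HasDerivAt (fun x => (eta a b x)⁻¹) (-(b x / a x) / eta a b x) x := by
    intro x hx
    refine ((hab.hasDerivAt_eta hx).inv (eta_pos a b x).ne').congr_deriv ?_
    have he := (eta_pos a b x).ne'
    field_simp
  have hη' : ContinuousOn (fun x => -(b x / a x) / eta a b x) (Ioo 0 1) :=
    hab.continuousOn_div.neg.div (hab.continuousOn_eta.mono Ioo_subset_Icc_self)
      fun x _ => (eta_pos a b x).ne'
  have hd : HasWeakDeriv u.d (fun x => -(b x / a x) * u.d x + q x / a x) := by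
    refine (hflux.mul_of_hasDerivAt hη hη').congr ?_ ?_
    · refine Eventually.of_forall fun x => ?_
      exact inv_mul_cancel_left₀ (eta_pos a b x).ne' _
    · filter_upwards [ae_restrict_mem measurableSet_Ioo] with x hx
      have ha := (hab.a_pos x (Ioo_subset_Ioc_self hx)).ne'
      have he := (eta_pos a b x).ne'
      rw [sigma]
      field_simp
  have hA : (fun x => a x * u.dd x + b x * u.d x) =ᵐ[leb] q := by
    filter_upwards [hd.weakDeriv_ae, ae_restrict_mem measurableSet_Ioo] with x h1 hx
    have ha := (hab.a_pos x (Ioo_subset_Ioc_self hx)).ne'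
    rw [H1.dd, h1]
    field_simp
    ring
  have hA' : (fun x => a x * u.dd x + b x * u.d x) =ᵐ[wMeasure a b] q := ae_w_of_ae hA
  have hu : u ∈ H2 a b := ⟨⟨_, hd⟩, (memLp_congr_ae hA').2 (Lp.memLp q)⟩
  refine ⟨hu, ?_, ?_⟩
  · refine Lp.ext ?_
    exact hu.2.coeFn_toLp.trans hA'
  · obtain ⟨p, hp, hpe⟩ := hab.exists_isPrimitive_to_one (Lp.memLp q) hflux
    refine ⟨p, continuousOn_Ioc_of_isPrimitive hp, hpe, ?_⟩
    -- This function is `0` for `x ≤ 1/2` and `1` at `x = 1`.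
    have hφ : ContDiff ℝ 1 fun x : ℝ => Real.smoothTransition (2 * x - 1) :=
      Real.smoothTransition.contDiff.comp ((contDiff_const.mul contDiff_id).sub contDiff_const)
    obtain ⟨v, hv, hvd⟩ := hab.exists_h1_of_contDiff hφ (δ := 1 / 2) (by norm_num) fun x hx =>
      Real.smoothTransition.zero_of_nonpos (by linarith)
    have hv1 : v.one = 1 := by
      rw [H1.one, ← ext_one, hv 1 (right_mem_Icc.2 zero_le_one)]
      exact Real.smoothTransition.one_of_one_le (by norm_num)
    have hp2 : MemLp p 2 leb := (memLp_congr_ae hpe).2 (hab.memLp_eta_mul u.memLp_d)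
    have h1 := hab.green hp hp2 (Lp.memLp q) v
    have h2 := h v
    rw [hv1, mul_one, hab.inner_toL2, dirichlet_eq_of_ae (EventuallyEq.refl _ _)] at h2
    rw [hv1, mul_one] at h1
    rw [← h1, ← h2]
    congr 1
    refine integral_congr_ae ?_
    filter_upwards [hpe] with x hx
    rw [hx]

/-! ### The range of `l - 𝒜` -/

/-- The inner product of a real inner product space as a bounded bilinear form. -/
def realInnerL (E : Type*) [NormedAddCommGroup E] [InnerProductSpace ℝ E] : E →L[ℝ] E →L[ℝ] ℝ :=
  (innerₗ E).mkContinuous₂ 1 fun x y => by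
    rw [one_mul]
    exact norm_inner_le_norm x y

/-- Lax–Milgram for `l² u - A u = h` with the boundary condition `(η u')(1) + (l + β) u(1) = r`. -/
theorem exists_weak_solution (hab : Admissible a b) (hβ : 0 ≤ β) {l : ℝ} (hl : 1 ≤ l)
    (h : L2w a b) (r : ℝ) :
    ∃ u : H1 a b, ∀ φ : H1 a b, dirichlet u φ + l ^ 2 * ⟪H1.toL2 u, H1.toL2 φ⟫_ℝ
      + (l + β) * (u.one * φ.one) = ⟪h, H1.toL2 φ⟫_ℝ + r * φ.one := by
  let I : FormDomain hab hβ →L[ℝ] L2w a b := FormDomain.toL2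
  let e : FormDomain hab hβ →L[ℝ] ℝ := FormDomain.evalOne
  -- The inner product already contains one copy of `∫uφ/σ` and the term `βu(1)φ(1)`. The remaining
  -- coefficients `l² - 1` and `l` are nonnegative for `l ≥ 1`, so the coercivity constant is `1`.
  let B : FormDomain hab hβ →L[ℝ] FormDomain hab hβ →L[ℝ] ℝ :=
    realInnerL (FormDomain hab hβ) + (l ^ 2 - 1) • (realInnerL (L2w a b)).bilinearComp I I
      + l • (ContinuousLinearMap.mul ℝ ℝ).bilinearComp e e
  have hB : ∀ u φ, B u φ = ⟪u, φ⟫_ℝ + (l ^ 2 - 1) * ⟪I u, I φ⟫_ℝ + l * (e u * e φ) :=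
    fun u φ => rfl
  have hcoer : IsCoercive B := by
    refine ⟨1, one_pos, fun u => ?_⟩
    rw [hB, real_inner_self_eq_norm_sq, real_inner_self_eq_norm_sq]
    have h1 : 0 ≤ (l ^ 2 - 1) * ‖I u‖ ^ 2 := mul_nonneg (by nlinarith) (sq_nonneg _)
    have h2 : 0 ≤ l * (e u * e u) := mul_nonneg (by linarith) (mul_self_nonneg _)
    nlinarith
  let F : FormDomain hab hβ →L[ℝ] ℝ := (realInnerL (L2w a b) h).comp I + r • e
  let w := (InnerProductSpace.toDual ℝ (FormDomain hab hβ)).symm F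
  let u := hcoer.continuousLinearEquivOfBilin.symm w
  refine ⟨FormDomain.toH1 u, fun φ => ?_⟩
  have h1 := hcoer.continuousLinearEquivOfBilin_apply u (FormDomain.toH1.symm φ)
  rw [ContinuousLinearEquiv.apply_symm_apply, InnerProductSpace.toDual_symm_apply, hB,
    FormDomain.inner_eq] at h1
  change ⟪h, H1.toL2 φ⟫_ℝ + r * φ.one = dirichlet (FormDomain.toH1 u) φ
    + ⟪H1.toL2 (FormDomain.toH1 u), H1.toL2 φ⟫_ℝ + β * ((FormDomain.toH1 u).one * φ.one)
    + (l ^ 2 - 1) * ⟪H1.toL2 (FormDomain.toH1 u), H1.toL2 φ⟫_ℝ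
    + l * ((FormDomain.toH1 u).one * φ.one) at h1
  linarith

/-- Eliminating `v = lu - f` leaves `l²u - Au = g + lf`, and the boundary condition becomes
`(ηu')(1) = f(1) - (l + β)u(1)`. -/
theorem exists_resolvent_eq (hab : Admissible a b) (hβ : 0 ≤ β) {l : ℝ} (hl : 1 ≤ l)
    (Z : EnergySpace hab hβ) :
    ∃ X Y, (X, Y) ∈ (waveOperator hab hβ).graph ∧ l • X - Y = Z := by
  obtain ⟨f, g⟩ := Z
  obtain ⟨u, hu⟩ := exists_weak_solution hab hβ hl (g + l • H1.toL2 f) f.one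
  obtain ⟨hu2, hA, hval⟩ := exists_h2_of_weak hab (u := u)
    (q := l ^ 2 • H1.toL2 u - (g + l • H1.toL2 f)) (d := f.one - (l + β) * u.one) fun φ => by
      rw [inner_sub_left, real_inner_smul_left]
      linarith [hu φ]
  let v : H1 a b := l • u - f
  have hv1 : v.one = l * u.one - f.one := rfl
  let q : bcPairs a b β := ⟨(⟨u, hu2⟩, v), _, hval, by
    change f.one - (l + β) * u.one + v.one + β * u.one = 0
    rw [hv1]
    ring⟩
  refine ⟨bcInclusion hab hβ q, bcAction hab hβ q,
    (mem_graph_waveOperator_iff hab hβ _ _).2 ⟨q, rfl, rfl⟩, Prod.ext ?_ ?_⟩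
  · change l • u - (l • u - f) = f
    rw [sub_sub_cancel]
  · change l • H1.toL2 v - opA a b ⟨u, hu2⟩ = g
    rw [hA, map_sub, map_smul, smul_sub, smul_smul, ← sq]
    abel

/-! ### Generation -/

/-- The energy space with the finer norm that controls `u` in `L²_{1/σ}(0,1)`. -/
def finerEquiv (hab : Admissible a b) (hβ : 0 ≤ β) :
    WithLp 2 (FormDomain hab hβ × L2w a b) ≃ₗ[ℝ] EnergySpace hab hβ :=
  (WithLp.linearEquiv 2 ℝ (FormDomain hab hβ × L2w a b)).trans
    { toFun := fun Y => EnergySpace.mk hab hβ (FormDomain.toH1 Y.1) Y.2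
      invFun := fun Y => (FormDomain.toH1.symm Y.1, Y.2)
      map_add' := fun _ _ => rfl
      map_smul' := fun _ _ => rfl
      left_inv := fun _ => rfl
      right_inv := fun _ => rfl }

theorem inner_finer_eq (hab : Admissible a b) (hβ : 0 ≤ β)
    (X Y : WithLp 2 (FormDomain hab hβ × L2w a b)) :
    ⟪X, Y⟫_ℝ = ⟪finerEquiv hab hβ X, finerEquiv hab hβ Y⟫_ℝ
      + ⟪H1.toL2 (finerEquiv hab hβ X).1, H1.toL2 (finerEquiv hab hβ Y).1⟫_ℝ := by
  rw [WithLp.prod_inner_apply, FormDomain.inner_eq]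
  change _ = dirichlet (FormDomain.toH1 X.ofLp.1) (FormDomain.toH1 Y.ofLp.1)
    + ⟪X.ofLp.2, Y.ofLp.2⟫_ℝ
    + β * ((FormDomain.toH1 X.ofLp.1).one * (FormDomain.toH1 Y.ofLp.1).one)
    + ⟪H1.toL2 (FormDomain.toH1 X.ofLp.1), H1.toL2 (FormDomain.toH1 Y.ofLp.1)⟫_ℝ
  ring

theorem continuous_finerEquiv (hab : Admissible a b) (hβ : 0 ≤ β) :
    Continuous (finerEquiv hab hβ) := by
  refine AddMonoidHomClass.continuous_of_bound (finerEquiv hab hβ) 1 fun X => ?_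
  rw [one_mul]
  refine le_of_sq_le_sq ?_ (norm_nonneg _)
  rw [← real_inner_self_eq_norm_sq, ← real_inner_self_eq_norm_sq X, inner_finer_eq]
  linarith [real_inner_self_nonneg (x := H1.toL2 (finerEquiv hab hβ X).1)]

/-- The first component of `𝒜(u,v)` is `v`, so the finer inner product adds only `∫vu/σ`, which is
at most half the sum of the squared norms of `u` and `v` in `L²_{1/σ}`; the finer norm controls
both. -/
theorem inner_finer_le (hab : Admissible a b) (hβ : 0 ≤ β)
    (X Y : WithLp 2 (FormDomain hab hβ × L2w a b))
    (h : (finerEquiv hab hβ X, finerEquiv hab hβ Y) ∈ (waveOperator hab hβ).graph) :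
    ⟪Y, X⟫_ℝ ≤ 1 * ‖X‖ ^ 2 := by
  rw [← real_inner_self_eq_norm_sq, inner_finer_eq, inner_finer_eq hab hβ X X]
  set x := finerEquiv hab hβ X
  set y := finerEquiv hab hβ Y
  obtain ⟨p, hp1, hp2⟩ := (LinearPMap.mem_graph_iff _).1 h
  have h1 := isDissipative_waveOperator hab hβ p
  rw [hp1, hp2] at h1
  obtain ⟨q, hq1, hq2⟩ := (mem_graph_waveOperator_iff hab hβ _ _).1 h
  have h2 : H1.toL2 y.1 = x.2 := by
    rw [← hq1, ← hq2]
    rfl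
  rw [h2, EnergySpace.inner_eq hab hβ x x, real_inner_self_eq_norm_sq, real_inner_self_eq_norm_sq]
  have h3 := real_inner_le_norm x.2 (H1.toL2 x.1)
  have h4 := mul_nonneg hβ (mul_self_nonneg x.1.one)
  have h5 := dirichlet_self_nonneg x.1
  change ⟪y, x⟫_ℝ ≤ 0 at h1
  nlinarith [sq_nonneg (‖x.2‖ - ‖H1.toL2 x.1‖), sq_nonneg ‖x.2‖, sq_nonneg ‖H1.toL2 x.1‖]

end

end DegenerateWave


theorem mainTheorem2 (a b : ℝ → ℝ) (β : ℝ) (hab : DegenerateWave.Admissible a b)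
    (hβ : 0 ≤ β) :
    DegenerateWave.IsDissipative (DegenerateWave.waveOperator hab hβ) ∧
    Dense ((DegenerateWave.waveOperator hab hβ).domain :
      Set (DegenerateWave.EnergySpace hab hβ)) ∧
    ∃ S : ℝ≥0 → DegenerateWave.EnergySpace hab hβ →L[ℝ] DegenerateWave.EnergySpace hab hβ,
      DegenerateWave.IsContractionSemigroup S ∧
      DegenerateWave.IsGenerator (DegenerateWave.waveOperator hab hβ) S :=
  have hdiss := DegenerateWave.isDissipative_waveOperator hab hβ
  ⟨hdiss, DegenerateWave.exists_generator_of_finer_hilbert _ hdiss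
    (DegenerateWave.finerEquiv hab hβ) (DegenerateWave.continuous_finerEquiv hab hβ) zero_le_one
    (DegenerateWave.inner_finer_le hab hβ)
    fun _ hl => DegenerateWave.exists_resolvent_eq hab hβ hl.le⟩
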